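/- **Setting.** Let $\mathcal H_p,\mathcal H_d,\mathcal H_v$ be real Hilbert spaces with their Borel $\sigma$-algebras, $A:\mathcal H_p\to\mathcal H_d$ and $T:\mathcal H_p\to\mathcal H_v$ bounded linear operators, and $b\in\mathcal H_d$. $\Gamma_0(\mathcal H)$ denotes the proper, convex, lower semicontinuous functions $\mathcal H\to\mathbb R\cup\{+\infty\}$, and $\operatorname{dom}$ the set where a function is $<+\infty$. Let $f,h:\mathcal H_p\to\mathbb R\cup\{+\infty\}$, $g:\mathcal H_v\to\mathbb R\cup\{+\infty\}$, $C=\operatorname{dom}h$, and assume: - (A.1) $f,\,g\circ T,\,h\in\Gamma_0(\mathcal H_p)$ and $g\in\Gamma_0(\mathcal H_v)$. - (A.2) $(f,C)$ is $(F,\zeta)$-smooth for some $F:\mathcal H_p\to\mathbb R\cup\{+\infty\}$ and $\zeta:(0,1]\to[0,\infty)$: $C\subset\operatorname{dom}f$ and there is an open set $C_0$ with $C\subset C_0\subset\operatorname{int}\operatorname{dom}F$ such that $f$ is finite on $C_0$, $F$ and $f$ are (Fréchet) differentiable on $C_0$, $F-f$ is convex on $C_0$ (i.e. on every convex subset of $C_0$),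 and for some constant $K<\infty$, $D_F(z,x):=F(z)-F(x)-\langle\nabla F(x),z-x\rangle\le K\zeta(\gamma)$ whenever $x,s\in C$, $\gamma\in(0,1]$, $z=x+\gamma(s-x)$. - (A.3) $C$ is weakly compact. - (A.4) $\partial g(Tx)\neq\emptyset$ for all $x\in C$, and the minimal-norm elements $[\partial g(Tx)]^0$ of $\partial g(Tx)$ satisfy $\sup_{x\in C}\|[\partial g(Tx)]^0\|<\infty$. - (A.6) The Lagrangian $\mathcal L(x,\mu)=f(x)+g(Tx)+h(x)+\langle\mu,Ax-b\rangle$ has a saddle point $(x^\star,\mu^\star)$, i.e. $\mathcal L(x^\star,\mu)\le\mathcal L(x^\star,\mu^\star)\le\mathcal L(x,\mu^\star)$ for all $x\in\mathcal H_p$, $\mu\in\mathcal H_d$. **Parameters.** Let $(\gamma_k),(\beta_k),(\theta_k),(\rho_k)$, $k\ge0$, be real sequences such that: - (P.1) $\gamma_k\in(0,1]$ and $\sum_k\zeta(\gamma_k)$, $\sum_k\gamma_k^2/\beta_k$, $\sum_k\gamma_k\beta_k$ are finite; (P.2) $\sum_k\gamma_k=\infty$; - (P.3) $\beta_k>0$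 is nonincreasing and $\beta_k\to0$; (P.4) $(\rho_k)$ is nondecreasing with $0<\underline\rho\le\rho_k\le\overline\rho<\infty$; - (P.5) $\underline M\le\gamma_k/\gamma_{k+1}\le\overline M$ for some constants $\underline M,\overline M>0$; (P.6) $\theta_k=\gamma_k/c$ for some $c>0$ with $\overline M/c-\underline\rho/2<0$. **Algorithm (ICGALP).** On a probability space, let $x_0$ ($C$-valued), $\mu_0$ ($\operatorname{ran}(A)$-valued), $\widehat s_k$, $\lambda_k$ ($\mathcal H_p$-valued) and $\lambda^s_k$ ($[0,\infty)$-valued) be random variables such that almost surely, for all $k\ge0$, $$y_k=\operatorname{prox}_{\beta_kg}(Tx_k)=\operatorname*{argmin}_{y}\Big\{g(y)+\tfrac1{2\beta_k}\|Tx_k-y\|^2\Big\},$$ $$z_k=\nabla f(x_k)+T^*(Tx_k-y_k)/\beta_k+A^*\mu_k+\rho_kA^*(Ax_k-b)+\lambda_k,$$ $$s_k\in\operatorname*{Argmin}_{s\in\mathcal H_p}\{h(s)+\langle z_k,s\rangle\},\qquad h(\widehat s_k)+\langle z_k,\widehat s_k\rangle\le h(s_k)+\langle z_k,s_k\rangle+\lambda^s_k,$$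 $$x_{k+1}=x_k-\gamma_k(x_k-\widehat s_k),\qquad \mu_{k+1}=\mu_k+\theta_k(Ax_{k+1}-b).$$ Let $\mathcal S_k=\sigma(x_0,\mu_0,\widehat s_0,\dots,\widehat s_k)$ and assume - (P.8) almost surely $\sum_k\gamma_{k+1}\mathbb E[\|\lambda_{k+1}\|\mid\mathcal S_k]<\infty$ and $\sum_k\gamma_{k+1}\mathbb E[\lambda^s_{k+1}\mid\mathcal S_k]<\infty$, where conditional expectations of nonnegative random variables are $[0,+\infty]$-valued. **Theorem (Feasibility).** Let $\Gamma_k=\sum_{i=0}^k\gamma_i$ and $\bar x_k=\Gamma_k^{-1}\sum_{i=0}^k\gamma_ix_i$. Then, almost surely (the constants in $O(\cdot)$ and the subsequence may depend on the realization): 1. $\lim_{k\to\infty}\|Ax_k-b\|=0$; 2. $\inf_{0\le i\le k}\|Ax_i-b\|=O(1/\sqrt{\Gamma_k})$, and there is a subsequence $(x_{k_j})_j$ with $\|Ax_{k_j}-b\|\le1/\sqrt{\Gamma_{k_j}}$ for all $j$; 3. $\|A\bar x_k-b\|=O(1/\sqrt{\Gamma_k})$. -/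

import Mathlib

open MeasureTheory Filter Topology Asymptotics
open scoped NNReal ENNReal

noncomputable section

namespace ICGALP

section ConvexAnalysis

variable {H : Type*} [NormedAddCommGroup H] [InnerProductSpace ℝ H]

/-- The effective domain `dom f = {x | f x < +∞}` of an extended-real-valued function. -/
def edom (f : H → EReal) : Set H := {x | f x < ⊤}

/-- The real-valued function that agrees with `f` wherever `f` is finite. -/
def realVal (f : H → EReal) : H → ℝ := fun x => (f x).toReal

/-- The class `Γ₀(H)` of functions `H → ℝ ∪ {+∞}` that are proper, convex (i.e. with convex
epigraph) and lower semicontinuous. -/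
structure IsGammaZero (f : H → EReal) : Prop where
  ne_bot : ∀ x, f x ≠ ⊥
  proper : (edom f).Nonempty
  convex : Convex ℝ {p : H × ℝ | f p.1 ≤ (p.2 : EReal)}
  lsc : LowerSemicontinuous f

/-- The subdifferential `∂f(x) = {u | f y ≥ f x + ⟪u, y - x⟫ for all y}`. -/
def subdiff (f : H → EReal) (x : H) : Set H :=
  {u | ∀ y, f x + ((inner ℝ u (y - x) : ℝ) : EReal) ≤ f y}

/-- `u = [∂f(x)]⁰`, the element of `∂f(x)` of minimal norm. -/
def IsMinNormSubgrad (f : H → EReal) (x u : H) : Prop :=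
  u ∈ subdiff f x ∧ ∀ v ∈ subdiff f x, ‖u‖ ≤ ‖v‖

/-- `y = prox_{βf}(x)`: the point `y` minimizes `f + ‖x - ·‖² / (2β)` over `H`. -/
def IsProx (β : ℝ) (f : H → EReal) (x y : H) : Prop :=
  ∀ w, f y + ((1 / (2 * β) * ‖x - y‖ ^ 2 : ℝ) : EReal) ≤
    f w + ((1 / (2 * β) * ‖x - w‖ ^ 2 : ℝ) : EReal)

/-- The objective `s ↦ h(s) + ⟪z, s⟫` of the linear minimization oracle. -/
def lmo (h : H → EReal) (z s : H) : EReal := h s + ((inner ℝ z s : ℝ) : EReal)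

/-- Compactness for the weak topology of `H`. -/
def IsWeaklyCompact (C : Set H) : Prop := IsCompact (toWeakSpace ℝ H '' C)

variable [CompleteSpace H]

/-- The Bregman divergence `D_F(x, y) = F(x) - F(y) - ⟪∇F(y), x - y⟫`, for `F` finite at `x` and
finite and differentiable near `y`. -/
def bregman (F : H → EReal) (x y : H) : ℝ :=
  realVal F x - realVal F y - inner ℝ (gradient (realVal F) y) (x - y)

/-- `(F, ζ)`-smoothness of the pair `(f, C)`; only the values of `ζ` on `(0, 1]` matter.
As `C₀` need not be convex, convexity of `F - f` on `C₀` is read as convexity on every convex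
subset of `C₀`. The last clause says that the supremum of `D_F(z, x) / ζ(γ)`, over `x, s ∈ C`,
`γ ∈ (0, 1]`, `z = x + γ(s - x)`, is finite (a positive number divided by `0` being `+∞`). -/
def IsFZetaSmooth (F : H → EReal) (ζ : ℝ → ℝ) (f : H → EReal) (C : Set H) : Prop :=
  (∀ x, F x ≠ ⊥) ∧ (∀ t ∈ Set.Ioc (0 : ℝ) 1, 0 ≤ ζ t) ∧ C ⊆ edom f ∧
  ∃ C₀ : Set H, IsOpen C₀ ∧ C ⊆ C₀ ∧ C₀ ⊆ interior (edom F) ∧ C₀ ⊆ edom f ∧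
    DifferentiableOn ℝ (realVal F) C₀ ∧ DifferentiableOn ℝ (realVal f) C₀ ∧
    (∀ K ⊆ C₀, Convex ℝ K → ConvexOn ℝ K (fun x => realVal F x - realVal f x)) ∧
    ∃ κ : ℝ, ∀ x ∈ C, ∀ s ∈ C, ∀ t ∈ Set.Ioc (0 : ℝ) 1,
      bregman F (x + t • (s - x)) x ≤ κ * ζ t

end ConvexAnalysis

section Problem

variable {Hp Hd Hv : Type*}
  [NormedAddCommGroup Hp] [InnerProductSpace ℝ Hp]
  [NormedAddCommGroup Hd] [InnerProductSpace ℝ Hd]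
  [NormedAddCommGroup Hv] [InnerProductSpace ℝ Hv]

/-- The Lagrangian `f(x) + g(Tx) + h(x) + ⟪μ, Ax - b⟫`. -/
def lagrangian (f : Hp → EReal) (g : Hv → EReal) (h : Hp → EReal)
    (T : Hp →L[ℝ] Hv) (A : Hp →L[ℝ] Hd) (b : Hd) (x : Hp) (μ : Hd) : EReal :=
  f x + g (T x) + h x + ((inner ℝ μ (A x - b) : ℝ) : EReal)

/-- `(x', μ')` is a saddle point of the Lagrangian. -/
def IsSaddlePoint (f : Hp → EReal) (g : Hv → EReal) (h : Hp → EReal)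
    (T : Hp →L[ℝ] Hv) (A : Hp →L[ℝ] Hd) (b : Hd) (x' : Hp) (μ' : Hd) : Prop :=
  ∀ x μ, lagrangian f g h T A b x' μ ≤ lagrangian f g h T A b x' μ' ∧
    lagrangian f g h T A b x' μ' ≤ lagrangian f g h T A b x μ'

/-- The step-size, smoothing and penalty parameters. -/
structure Params where
  γ : ℕ → ℝ
  β : ℕ → ℝ
  θ : ℕ → ℝ
  ρ : ℕ → ℝ

variable [CompleteSpace Hp] [CompleteSpace Hd] [CompleteSpace Hv]

/-- The assumptions on the problem data, with `C = dom h`. -/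
structure ProblemAssumptions (f : Hp → EReal) (g : Hv → EReal) (h : Hp → EReal)
    (T : Hp →L[ℝ] Hv) (A : Hp →L[ℝ] Hd) (b : Hd) (F : Hp → EReal) (ζ : ℝ → ℝ) : Prop where
  f_mem : IsGammaZero f
  g_mem : IsGammaZero g
  gT_mem : IsGammaZero (fun x => g (T x))
  h_mem : IsGammaZero h
  smooth : IsFZetaSmooth F ζ f (edom h)
  weaklyCompact : IsWeaklyCompact (edom h)
  subdiff_nonempty : ∀ x ∈ edom h, (subdiff g (T x)).Nonempty
  subdiff_bounded : ∃ M : ℝ, ∀ x ∈ edom h, ∀ u, IsMinNormSubgrad g (T x) u → ‖u‖ ≤ M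
  saddle : ∃ x' μ', IsSaddlePoint f g h T A b x' μ'

/-- The assumptions on the (deterministic) parameters. -/
structure ParamAssumptions (ζ : ℝ → ℝ) (p : Params) : Prop where
  γ_mem : ∀ k, p.γ k ∈ Set.Ioc (0 : ℝ) 1
  ζγ_summable : Summable (fun k => ζ (p.γ k))
  γsqβ_summable : Summable (fun k => p.γ k ^ 2 / p.β k)
  γβ_summable : Summable (fun k => p.γ k * p.β k)
  γ_not_summable : ¬ Summable p.γ
  β_pos : ∀ k, 0 < p.β k
  β_antitone : Antitone p.β
  β_tendsto : Tendsto p.β atTop (𝓝 0)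
  ρ_monotone : Monotone p.ρ
  /-- There are `0 < ρ₁ ≤ ρ_k ≤ ρ₂`, `0 < γ₁ ≤ γ_k / γ_{k+1} ≤ γ₂` and `c > 0` with
  `θ_k = γ_k / c` and `γ₂ / c - ρ₁ / 2 < 0`. -/
  bounds : ∃ ρ₁ ρ₂ γ₁ γ₂ c : ℝ, 0 < ρ₁ ∧ (∀ k, ρ₁ ≤ p.ρ k ∧ p.ρ k ≤ ρ₂) ∧
    0 < γ₁ ∧ 0 < γ₂ ∧ (∀ k, γ₁ ≤ p.γ k / p.γ (k + 1) ∧ p.γ k / p.γ (k + 1) ≤ γ₂) ∧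
    0 < c ∧ (∀ k, p.θ k = p.γ k / c) ∧ γ₂ / c - ρ₁ / 2 < 0

/-- One trajectory of the algorithm: `x, μ` are the primal and dual iterates, `y, z, s, s'` the
auxiliary points (`s'` the inexact linear minimization step), `e k` the error in the gradient and
proximal terms and `ε k` the error in the linear minimization oracle. -/
structure IsTrajectory (f : Hp → EReal) (g : Hv → EReal) (h : Hp → EReal)
    (T : Hp →L[ℝ] Hv) (A : Hp →L[ℝ] Hd) (b : Hd) (p : Params)
    (x : ℕ → Hp) (μ : ℕ → Hd) (y : ℕ → Hv) (z s s' : ℕ → Hp) (e : ℕ → Hp) (ε : ℕ → ℝ≥0) :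
    Prop where
  x_zero : x 0 ∈ edom h
  μ_zero : μ 0 ∈ Set.range A
  y_step : ∀ k, IsProx (p.β k) g (T (x k)) (y k)
  z_step : ∀ k, z k = gradient (realVal f) (x k)
    + (p.β k)⁻¹ • ContinuousLinearMap.adjoint T (T (x k) - y k)
    + ContinuousLinearMap.adjoint A (μ k)
    + p.ρ k • ContinuousLinearMap.adjoint A (A (x k) - b) + e k
  s_step : ∀ k w, lmo h (z k) (s k) ≤ lmo h (z k) w
  s'_step : ∀ k, lmo h (z k) (s' k) ≤ lmo h (z k) (s k) + ((ε k : ℝ) : EReal)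
  x_step : ∀ k, x (k + 1) = x k - p.γ k • (x k - s' k)
  μ_step : ∀ k, μ (k + 1) = μ k + p.θ k • (A (x (k + 1)) - b)

end Problem

/-- The `σ`-algebra generated by the random variables `x₀, μ₀, s'₀, …, s'ₖ`. -/
abbrev sigmaAlg {Ω Hp Hd : Type*} [MeasurableSpace Hp] [MeasurableSpace Hd]
    (x₀ : Ω → Hp) (μ₀ : Ω → Hd) (s' : ℕ → Ω → Hp) (k : ℕ) : MeasurableSpace Ω :=
  MeasurableSpace.comap x₀ inferInstance ⊔ MeasurableSpace.comap μ₀ inferInstance ⊔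
    ⨆ i : Fin (k + 1), MeasurableSpace.comap (s' i) inferInstance

/-- `Γ_k = γ_0 + ⋯ + γ_k`. -/
def cumStep (γ : ℕ → ℝ) (k : ℕ) : ℝ := ∑ i ∈ Finset.range (k + 1), γ i

/-- The ergodic average `(γ_0 x_0 + ⋯ + γ_k x_k) / Γ_k`. -/
def ergodicAvg {H : Type*} [AddCommGroup H] [Module ℝ H] (γ : ℕ → ℝ) (x : ℕ → H) (k : ℕ) : H :=
  (cumStep γ k)⁻¹ • ∑ i ∈ Finset.range (k + 1), γ i • x i

/-- The random sequence `γ_{k+1} E[X_{k+1} | 𝒮_k]` is almost surely summable, where `X_k ≥ 0` and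
the conditional expectation of a nonnegative random variable takes values in `[0, +∞]`. -/
def CondSummable {Ω : Type*} [MeasurableSpace Ω] (P : Measure Ω) (S : ℕ → MeasurableSpace Ω)
    (γ : ℕ → ℝ) (X : ℕ → Ω → ℝ≥0∞) : Prop :=
  ∀ᵐ ω ∂P, ∑' k, ENNReal.ofReal (γ (k + 1)) * condLExp (S k) P (X (k + 1)) ω < ⊤

end ICGALP

end

/-! Everything rests on Σ γ_k ‖A x_k - b‖² < ∞ along almost every trajectory
(`IsTrajectory.summable_mul_sq`). Once `ae_tsum_lt_top_of_condLExp` has made the errors pathwise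
summable, the argument is deterministic.

Let J_k(x, v) be `augLag` at step k, with the smoothing of g split off into the variable v; let φ_k
be its infimum over dom h × dom g (a dual value) and (x̃_k, ỹ_k) a 2⁻ᵏ-minimizer. The potential is
J_k(x_k, y_k) - 2 φ_k. Up to summable errors, the conditional gradient step lowers it by γ_k ρ_k/2
‖A x_k - A x̃_k‖², thanks to the curvature of the penalty. The multiplier step raises J by θ_k ‖A
x_{k+1} - b‖², but up to 2⁻⁽ᵏ⁺¹⁾ raises φ by at least θ_k ⟪A x_{k+1} - b, A x̃_{k+1} - b⟫. As φ
counts twice, the net change is θ_k (‖A x_{k+1} - A x̃_{k+1}‖² - ‖A x̃_{k+1} - b‖²), whose positive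
part is absorbed by the next primal decrease because γ₂/c < ρ₁/2. The potential is bounded below,
since J_k(x_k, y_k) ≥ φ_k and φ_k is at most the objective at a feasible point. Hence both squared
distances are γ-summable, and the triangle inequality concludes.

The rates then follow from Cauchy-Schwarz and Abel-Dini, and the limit from telescoping the cubes of
the gaps. -/

namespace ICGALP

/-! ### From conditional to pathwise summability -/

section Probability

variable {Ω : Type*} {m : MeasurableSpace Ω}

/-- Partial sums increase, so the retained terms form an initial segment whose total is itself a
partial sum bounded by N. -/
lemma sum_indicator_partialSum_le (Y : ℕ → ℝ≥0∞) (N : ℝ≥0∞) (n : ℕ) :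
    ∑ k ∈ Finset.range n, (if ∑ j ∈ Finset.range (k + 1), Y j ≤ N then Y k else 0) ≤ N := by
  induction n with
  | zero => simp
  | succ n ih =>
    by_cases hn : ∑ j ∈ Finset.range (n + 1), Y j ≤ N
    · refine le_trans (Finset.sum_le_sum fun k _ => ?_) hn
      split_ifs
      · exact le_rfl
      · exact zero_le
    · rw [Finset.sum_range_succ, if_neg hn, add_zero]
      exact ih

/-- A sequence of nonnegative random variables whose conditional expectations along a filtration
are almost surely summable is almost surely summable. -/
lemma ae_tsum_lt_top_of_condLExp (P : Measure Ω) [IsFiniteMeasure P] {S : ℕ → MeasurableSpace Ω}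
    (hmono : Monotone S) (hle : ∀ k, S k ≤ m) {X : ℕ → Ω → ℝ≥0∞} (hX : ∀ k, Measurable (X k))
    (c : ℕ → ℝ≥0∞) (h : ∀ᵐ ω ∂P, ∑' k, c k * condLExp (S k) P (X k) ω < ⊤) :
    ∀ᵐ ω ∂P, ∑' k, c k * X k ω < ⊤ := by
  set Y : ℕ → Ω → ℝ≥0∞ := fun k ω => c k * condLExp (S k) P (X k) ω with hY
  have hYm : ∀ k, Measurable[S k] (Y k) := fun k => (measurable_condLExp (S k) P (X k)).const_mul _
  -- Stopping at level N: `E N k` is `S k`-measurable, so on it X_k and its conditional expectation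
  -- have equal integrals. Where the conditional series is below N, no term is cut off.
  let E : ℕ → ℕ → Set Ω := fun N k => {ω | ∑ j ∈ Finset.range (k + 1), Y j ω ≤ N}
  have hE : ∀ N k, MeasurableSet[S k] (E N k) := by
    intro N k
    have hsum : Measurable[S k] fun ω => ∑ j ∈ Finset.range (k + 1), Y j ω :=
      Finset.measurable_sum _ fun j hj =>
        (hYm j).mono (hmono (Nat.lt_succ_iff.mp (Finset.mem_range.mp hj))) le_rfl
    exact hsum measurableSet_Iic
  have hbound : ∀ N : ℕ, ∫⁻ ω, ∑' k, (E N k).indicator (fun ω => c k * X k ω) ω ∂P ≤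
      N * P Set.univ := by
    intro N
    rw [lintegral_tsum fun k =>
      (((hX k).const_mul _).indicator (hle k _ (hE N k))).aemeasurable]
    have heq : ∀ k, ∫⁻ ω, (E N k).indicator (fun ω => c k * X k ω) ω ∂P =
        ∫⁻ ω, (E N k).indicator (Y k) ω ∂P := by
      intro k
      rw [lintegral_indicator (hle k _ (hE N k)), lintegral_indicator (hle k _ (hE N k)),
        lintegral_const_mul _ (hX k), hY, lintegral_const_mul _ (measurable_condLExp' _ _ _),
        setLIntegral_condLExp (hle k) P (X k) (hE N k)]
    simp_rw [heq]
    rw [← lintegral_tsum fun k =>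
      (((hYm k).mono (hle k) le_rfl).indicator (hle k _ (hE N k))).aemeasurable]
    calc _ ≤ ∫⁻ _, (N : ℝ≥0∞) ∂P := by
          refine lintegral_mono fun ω => ?_
          refine ENNReal.tsum_le_of_sum_range_le fun n => ?_
          refine le_trans (le_of_eq (Finset.sum_congr rfl fun k _ => ?_))
            (sum_indicator_partialSum_le (fun j => Y j ω) N n)
          simp only [Set.indicator_apply, E, Set.mem_ofPred_eq]
      _ = N * P Set.univ := lintegral_const _
  have hfin : ∀ N : ℕ, ∀ᵐ ω ∂P, ∑' k, (E N k).indicator (fun ω => c k * X k ω) ω < ⊤ := by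
    intro N
    refine ae_lt_top' ?_ ((hbound N).trans_lt
      (ENNReal.mul_lt_top (ENNReal.natCast_lt_top N) (measure_lt_top P _))).ne
    exact (Measurable.tsum fun k =>
      ((hX k).const_mul _).indicator (hle k _ (hE N k))).aemeasurable
  filter_upwards [h, ae_all_iff.mpr hfin] with ω hω hfinω
  obtain ⟨N, hN⟩ := ENNReal.exists_nat_gt hω.ne
  refine lt_of_le_of_lt (le_of_eq (tsum_congr fun k => ?_)) (hfinω N)
  rw [Set.indicator_of_mem]
  exact (ENNReal.sum_le_tsum _).trans hN.le

lemma monotone_sigmaAlg {Hp Hd : Type*} [MeasurableSpace Hp] [MeasurableSpace Hd]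
    (x₀ : Ω → Hp) (μ₀ : Ω → Hd) (s' : ℕ → Ω → Hp) : Monotone (sigmaAlg x₀ μ₀ s') := by
  intro k l hkl
  refine sup_le_sup le_rfl (iSup_le fun i => ?_)
  exact le_iSup (fun i : Fin (l + 1) => MeasurableSpace.comap (s' i) inferInstance)
    ⟨i, by omega⟩

lemma sigmaAlg_le {Hp Hd : Type*} [MeasurableSpace Hp] [MeasurableSpace Hd]
    {x₀ : Ω → Hp} {μ₀ : Ω → Hd} {s' : ℕ → Ω → Hp} (hx₀ : Measurable x₀) (hμ₀ : Measurable μ₀)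
    (hs' : ∀ k, Measurable (s' k)) (k : ℕ) : sigmaAlg x₀ μ₀ s' k ≤ m :=
  sup_le (sup_le hx₀.comap_le hμ₀.comap_le) (iSup_le fun i => (hs' i).comap_le)

lemma CondSummable.ae_summable {P : Measure Ω} [IsFiniteMeasure P] {S : ℕ → MeasurableSpace Ω}
    {γ : ℕ → ℝ} {X : ℕ → Ω → ℝ≥0} (h : CondSummable P S γ fun k ω => (X k ω : ℝ≥0∞))
    (hmono : Monotone S) (hle : ∀ k, S k ≤ m) (hX : ∀ k, Measurable (X k)) (hγ : ∀ k, 0 ≤ γ k) :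
    ∀ᵐ ω ∂P, Summable fun k => γ k * (X k ω : ℝ) := by
  filter_upwards [ae_tsum_lt_top_of_condLExp P hmono hle
    (fun k => (hX (k + 1)).coe_nnreal_ennreal) _ h] with ω hω
  -- The conditional hypothesis starts at index 1; the term of index 0 is a single real number.
  rw [← summable_nat_add_iff 1]
  have := ENNReal.summable_toReal hω.ne
  refine this.congr fun k => ?_
  rw [ENNReal.toReal_mul, ENNReal.toReal_ofReal (hγ _), ENNReal.coe_toReal]

end Probability

/-! ### Weighted series and divergent step sizes -/

section Sequences

variable {γ a : ℕ → ℝ}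

/-- A nonnegative sequence with square summable for divergent weights, and whose increments are
controlled by the weights, tends to `0`. -/
lemma tendsto_zero_of_summable_mul_sq (hγ : ∀ k, 0 < γ k) (ha : ∀ k, 0 ≤ a k)
    (hdiv : ¬ Summable γ) (hsum : Summable fun k => γ k * a k ^ 2) {L M : ℝ}
    (hM : ∀ k, γ k ≤ M * γ (k + 1)) (hL : ∀ k, |a (k + 1) - a k| ≤ L * γ k) :
    Tendsto a atTop (𝓝 0) := by
  -- Cubes are the right power: an increment of a³ is an increment of a, of size γ_k, times a
  -- quadratic in a, hence is dominated by the summable γ a².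
  have hcube : Summable fun k => dist (a k ^ 3) (a k.succ ^ 3) := by
    have hL0 : 0 ≤ L := by
      have := (abs_nonneg _).trans (hL 0)
      exact nonneg_of_mul_nonneg_left this (hγ 0)
    have hs1 := (summable_nat_add_iff 1).mpr hsum
    refine Summable.of_nonneg_of_le (fun _ => dist_nonneg) (fun k => ?_)
      (((hsum.add (hs1.mul_left M))).mul_left (2 * L))
    rw [dist_comm, Real.dist_eq, Nat.succ_eq_add_one,
      show a (k + 1) ^ 3 - a k ^ 3 =
        (a (k + 1) - a k) * (a (k + 1) ^ 2 + a (k + 1) * a k + a k ^ 2) by ring, abs_mul,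
      abs_of_nonneg (a := a (k + 1) ^ 2 + a (k + 1) * a k + a k ^ 2)
        (by have := ha k; have := ha (k + 1); positivity)]
    have h1 : a (k + 1) ^ 2 + a (k + 1) * a k + a k ^ 2 ≤ 2 * (a k ^ 2 + a (k + 1) ^ 2) := by
      nlinarith [sq_nonneg (a k - a (k + 1))]
    calc _ ≤ L * γ k * (2 * (a k ^ 2 + a (k + 1) ^ 2)) :=
          mul_le_mul (hL k) h1 (by have := ha k; have := ha (k + 1); positivity)
            (mul_nonneg hL0 (hγ k).le)
      _ = 2 * L * (γ k * a k ^ 2 + γ k * a (k + 1) ^ 2) := by ring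
      _ ≤ 2 * L * (γ k * a k ^ 2 + M * γ (k + 1) * a (k + 1) ^ 2) := by
          gcongr
          exact hM k
      _ = _ := by ring
  obtain ⟨l, hl⟩ := cauchySeq_tendsto_of_complete (cauchySeq_of_summable_dist hcube)
  have hl0 : l ≤ 0 := by
    by_contra! hpos
    obtain ⟨δ, hδ, hδl⟩ : ∃ δ : ℝ, 0 < δ ∧ δ ^ 3 < l := by
      refine ⟨min 1 (l / 2), by positivity, ?_⟩
      have h1 : min 1 (l / 2) ≤ 1 := min_le_left _ _
      have h2 : min 1 (l / 2) ≤ l / 2 := min_le_right _ _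
      have h3 : 0 < min 1 (l / 2) := by positivity
      calc (min 1 (l / 2)) ^ 3 ≤ (min 1 (l / 2)) ^ 1 := pow_le_pow_of_le_one h3.le h1 (by norm_num)
        _ < l := by rw [pow_one]; linarith
    refine hdiv ?_
    have hev : ∀ᶠ k in atTop, ‖γ k‖ ≤ (δ ^ 2)⁻¹ * (γ k * a k ^ 2) := by
      filter_upwards [hl.eventually (lt_mem_nhds hδl)] with k hk
      have : δ ≤ a k := (lt_of_pow_lt_pow_left₀ 3 (ha k) hk).le
      rw [Real.norm_of_nonneg (hγ k).le, inv_mul_eq_div, le_div_iff₀ (by positivity)]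
      have := hγ k
      gcongr
    exact (hsum.mul_left _).of_norm_bounded_eventually_nat hev
  have hl' : l = 0 := le_antisymm hl0 (ge_of_tendsto' hl fun k => pow_nonneg (ha k) 3)
  rw [hl'] at hl
  rw [Metric.tendsto_atTop] at hl ⊢
  intro ε hε
  obtain ⟨N, hN⟩ := hl (ε ^ 3) (by positivity)
  refine ⟨N, fun n hn => ?_⟩
  have := hN n hn
  rw [Real.dist_eq, sub_zero, abs_of_nonneg (pow_nonneg (ha n) 3)] at this
  rw [Real.dist_eq, sub_zero, abs_of_nonneg (ha n)]
  exact lt_of_pow_lt_pow_left₀ 3 hε.le this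

lemma cumStep_pos (hγ : ∀ k, 0 < γ k) (k : ℕ) : 0 < cumStep γ k :=
  Finset.sum_pos (fun i _ => hγ i) ⟨0, by simp⟩

lemma cumStep_succ (γ : ℕ → ℝ) (k : ℕ) : cumStep γ (k + 1) = cumStep γ k + γ (k + 1) :=
  Finset.sum_range_succ _ _

lemma tendsto_cumStep (hγ : ∀ k, 0 < γ k) (hdiv : ¬ Summable γ) :
    Tendsto (cumStep γ) atTop atTop :=
  (tendsto_add_atTop_iff_nat 1).mpr
    ((not_summable_iff_tendsto_nat_atTop_of_nonneg fun k => (hγ k).le).mp hdiv)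

/-- The Abel-Dini divergence criterion. -/
lemma not_summable_div_cumStep (hγ : ∀ k, 0 < γ k) (hdiv : ¬ Summable γ) :
    ¬ Summable fun k => γ k / cumStep γ k := by
  intro hs
  have htail := tendsto_sum_nat_add fun k => γ k / cumStep γ k
  -- The tail from N is below 1/2, yet the block from N until Γ has doubled contributes at least
  -- 1/2.
  obtain ⟨N, hN⟩ := (htail.eventually (gt_mem_nhds (show (0 : ℝ) < 1 / 2 by norm_num))).exists
  obtain ⟨n, hn⟩ :=
    ((tendsto_cumStep hγ hdiv).eventually_ge_atTop (2 * cumStep γ N)).exists_forall_of_atTop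
  have hn' := hn (n + N) (by omega)
  have hmono : Monotone (cumStep γ) := monotone_nat_of_le_succ fun k => by
    rw [cumStep_succ]; linarith [hγ (k + 1)]
  have hpos := cumStep_pos hγ (n + N)
  have hle : ∑ i ∈ Finset.range (n + 1), γ (i + N) / cumStep γ (i + N) < 1 / 2 :=
    lt_of_le_of_lt (((summable_nat_add_iff N).mpr hs).sum_le_tsum _ fun i _ =>
      (div_pos (hγ _) (cumStep_pos hγ _)).le) hN
  have hge : ∑ i ∈ Finset.range (n + 1), γ (i + N) / cumStep γ (n + N) ≤
      ∑ i ∈ Finset.range (n + 1), γ (i + N) / cumStep γ (i + N) := by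
    refine Finset.sum_le_sum fun i hi => ?_
    have := Finset.mem_range.mp hi
    exact div_le_div_of_nonneg_left (hγ _).le (cumStep_pos hγ _) (hmono (by omega))
  rw [← Finset.sum_div] at hge
  have hsplit : cumStep γ (n + N) ≤ cumStep γ N + ∑ i ∈ Finset.range (n + 1), γ (i + N) := by
    have h1 : cumStep γ (n + N) = ∑ i ∈ Finset.range N, γ i +
        ∑ i ∈ Finset.range (n + 1), γ (N + i) := by
      rw [← Finset.sum_range_add, cumStep, show n + N + 1 = N + (n + 1) by ring]
    have h2 : ∑ i ∈ Finset.range N, γ i ≤ cumStep γ N := by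
      rw [cumStep, Finset.sum_range_succ]; linarith [hγ N]
    simp only [add_comm N] at h1
    linarith
  have : 1 / 2 ≤ (∑ i ∈ Finset.range (n + 1), γ (i + N)) / cumStep γ (n + N) := by
    rw [le_div_iff₀ hpos]; linarith
  linarith

/-- Otherwise a_k² ≥ 1/Γ_k eventually, and Σ γ_k/Γ_k would converge, against Abel-Dini. -/
lemma exists_subseq_le_inv_sqrt_cumStep (hγ : ∀ k, 0 < γ k)
    (hdiv : ¬ Summable γ) (hsum : Summable fun k => γ k * a k ^ 2) :
    ∃ φ : ℕ → ℕ, StrictMono φ ∧ ∀ j, a (φ j) ≤ 1 / √(cumStep γ (φ j)) := by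
  refine extraction_of_frequently_atTop (P := fun k => a k ≤ 1 / √(cumStep γ k)) fun hev => ?_
  refine not_summable_div_cumStep hγ hdiv (hsum.of_norm_bounded_eventually_nat ?_)
  filter_upwards [hev] with k hk
  have hpos := cumStep_pos hγ k
  rw [Real.norm_of_nonneg (div_pos (hγ k) hpos).le, div_eq_mul_one_div]
  refine mul_le_mul_of_nonneg_left ?_ (hγ k).le
  calc 1 / cumStep γ k = (1 / √(cumStep γ k)) ^ 2 := by
        rw [div_pow, Real.sq_sqrt hpos.le, one_pow]
    _ ≤ a k ^ 2 := by
        have := (not_le.mp hk).le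
        gcongr

lemma iInf_isBigO_inv_sqrt_cumStep (hγ : ∀ k, 0 < γ k) (ha : ∀ k, 0 ≤ a k)
    (hsum : Summable fun k => γ k * a k ^ 2) :
    (fun k : ℕ => ⨅ i : Fin (k + 1), a i) =O[atTop] fun k => 1 / √(cumStep γ k) := by
  refine IsBigO.of_bound (√(∑' k, γ k * a k ^ 2)) (Eventually.of_forall fun k => ?_)
  have hpos := cumStep_pos hγ k
  have h0 : 0 ≤ ⨅ i : Fin (k + 1), a i := Real.iInf_nonneg fun i => ha i
  rw [Real.norm_of_nonneg h0, Real.norm_of_nonneg (by positivity), mul_one_div,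
    ← Real.sqrt_div' _ hpos.le]
  refine Real.le_sqrt_of_sq_le ?_
  rw [le_div_iff₀ hpos, cumStep, Finset.mul_sum]
  refine le_trans (Finset.sum_le_sum fun i hi => ?_)
    (hsum.sum_le_tsum (Finset.range (k + 1)) fun i _ => by have := hγ i; positivity)
  rw [mul_comm]
  have hle : ⨅ i : Fin (k + 1), a i ≤ a i :=
    ciInf_le (f := fun i : Fin (k + 1) => a i) (Set.finite_range _).bddBelow
      ⟨i, Finset.mem_range.mp hi⟩
  have := hγ i
  gcongr

/-- Cauchy-Schwarz for the factorization γ a = √γ · (√γ a). -/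
lemma weighted_mean_le_inv_sqrt_cumStep (hγ : ∀ k, 0 < γ k)
    (hsum : Summable fun k => γ k * a k ^ 2) (k : ℕ) :
    (cumStep γ k)⁻¹ * ∑ i ∈ Finset.range (k + 1), γ i * a i ≤
      √(∑' k, γ k * a k ^ 2) * (1 / √(cumStep γ k)) := by
  have hpos := cumStep_pos hγ k
  have hcs := Finset.sum_mul_sq_le_sq_mul_sq (Finset.range (k + 1)) (fun i => √(γ i))
    (fun i => √(γ i) * a i)
  have h1 : ∀ i, √(γ i) * (√(γ i) * a i) = γ i * a i := fun i => by
    rw [← mul_assoc, Real.mul_self_sqrt (hγ i).le]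
  have h2 : ∀ i, (√(γ i) * a i) ^ 2 = γ i * a i ^ 2 := fun i => by
    rw [mul_pow, Real.sq_sqrt (hγ i).le]
  simp only [h1, h2, Real.sq_sqrt (hγ _).le] at hcs
  have h3 := hsum.sum_le_tsum (Finset.range (k + 1)) fun i _ =>
    mul_nonneg (hγ i).le (sq_nonneg (a i))
  rw [mul_one_div, ← Real.sqrt_div' _ hpos.le]
  refine Real.le_sqrt_of_sq_le ?_
  rw [le_div_iff₀ hpos, mul_pow]
  change _ ≤ cumStep γ k * _ at hcs
  calc _ = (∑ i ∈ Finset.range (k + 1), γ i * a i) ^ 2 * (cumStep γ k)⁻¹ := by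
        field_simp
    _ ≤ (cumStep γ k * ∑' k, γ k * a k ^ 2) * (cumStep γ k)⁻¹ := by
        gcongr
        exact hcs.trans (by gcongr)
    _ = _ := by field_simp

end Sequences

/-! ### Subgradients, proximal points and smoothness -/

section ConvexFunctions

variable {H : Type*} [NormedAddCommGroup H] [InnerProductSpace ℝ H]

lemma IsGammaZero.coe_realVal {f : H → EReal} (hf : IsGammaZero f) {x : H} (hx : x ∈ edom f) :
    ((realVal f x : ℝ) : EReal) = f x :=
  EReal.coe_toReal (ne_of_lt hx) (hf.ne_bot x)

lemma IsGammaZero.convex_combo {f : H → EReal} (hf : IsGammaZero f) {x y : H} (hx : x ∈ edom f)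
    (hy : y ∈ edom f) {s t : ℝ} (hs : 0 ≤ s) (ht : 0 ≤ t) (hst : s + t = 1) :
    f (s • x + t • y) ≤ ((s * realVal f x + t * realVal f y : ℝ) : EReal) := by
  have hx' : ((x, realVal f x) : H × ℝ) ∈ {p : H × ℝ | f p.1 ≤ (p.2 : EReal)} :=
    (hf.coe_realVal hx).ge
  have hy' : ((y, realVal f y) : H × ℝ) ∈ {p : H × ℝ | f p.1 ≤ (p.2 : EReal)} :=
    (hf.coe_realVal hy).ge
  exact hf.convex hx' hy' hs ht hst

lemma IsGammaZero.convex_edom {f : H → EReal} (hf : IsGammaZero f) : Convex ℝ (edom f) :=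
  fun _ hx _ hy _ _ hs ht hst => (hf.convex_combo hx hy hs ht hst).trans_lt (EReal.coe_lt_top _)

lemma IsGammaZero.convexOn_realVal {f : H → EReal} (hf : IsGammaZero f) :
    ConvexOn ℝ (edom f) (realVal f) := by
  refine ⟨hf.convex_edom, fun x hx y hy s t hs ht hst => ?_⟩
  have h := hf.convex_combo hx hy hs ht hst
  rw [← hf.coe_realVal (hf.convex_edom hx hy hs ht hst), EReal.coe_le_coe_iff] at h
  simpa using h

lemma nonneg_of_forall_nonneg_add_mul {D c : ℝ} (h : ∀ t ∈ Set.Ioc (0 : ℝ) 1, 0 ≤ D + t * c) :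
    0 ≤ D := by
  have hlim : Tendsto (fun t : ℝ => D + t * c) (𝓝[>] 0) (𝓝 (D + 0 * c)) :=
    ((continuous_const.add (continuous_id.mul continuous_const)).tendsto 0).mono_left
      nhdsWithin_le_nhds
  rw [zero_mul, add_zero] at hlim
  refine ge_of_tendsto hlim ?_
  filter_upwards [Ioc_mem_nhdsGT (zero_lt_one (α := ℝ))] with t ht using h t ht

/-- The first-order characterization of convexity. -/
lemma inner_gradient_le_sub [CompleteSpace H] {φ : H → ℝ} {C : Set H} (hφ : ConvexOn ℝ C φ)
    {x y : H} (hx : x ∈ C) (hy : y ∈ C) (hd : DifferentiableAt ℝ φ x) :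
    inner ℝ (gradient φ x) (y - x) ≤ φ y - φ x := by
  have hconv : ConvexOn ℝ (AffineMap.lineMap x y ⁻¹' C) (φ ∘ AffineMap.lineMap (k := ℝ) x y) :=
    hφ.comp_affineMap _
  have hder : HasDerivAt (φ ∘ AffineMap.lineMap (k := ℝ) x y) (fderiv ℝ φ x (y - x)) 0 := by
    refine HasFDerivAt.comp_hasDerivAt (0 : ℝ) ?_ AffineMap.hasDerivAt_lineMap
    rw [AffineMap.lineMap_apply_zero]
    exact hd.hasFDerivAt
  have := hconv.le_slope_of_hasDerivAt (x := 0) (y := 1) (by simpa) (by simpa) zero_lt_one hder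
  rw [slope_def_field] at this
  simp only [Function.comp_apply, AffineMap.lineMap_apply_zero, AffineMap.lineMap_apply_one,
    sub_zero, div_one] at this
  rw [← toDual_gradient, InnerProductSpace.toDual_apply_apply] at this
  exact this

/-- Every continuous functional is bounded on C, so Banach-Steinhaus applies to C viewed as a family
of functionals. -/
lemma IsWeaklyCompact.exists_norm_le [CompleteSpace H] {C : Set H} (hC : IsWeaklyCompact C) :
    ∃ d, ∀ x ∈ C, ‖x‖ ≤ d := by
  have hb : ∀ v : H, ∃ c, ∀ x : C, ‖innerSL ℝ (x : H) v‖ ≤ c := by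
    intro v
    have hcont : Continuous fun x : WeakSpace ℝ H => innerSL ℝ v ((toWeakSpace ℝ H).symm x) :=
      WeakBilin.eval_continuous (topDualPairing ℝ H).flip (innerSL ℝ v)
    obtain ⟨c, hc⟩ := (hC.image hcont).isBounded.exists_norm_le
    refine ⟨c, fun x => ?_⟩
    have := hc _ ⟨_, ⟨x, x.2, rfl⟩, rfl⟩
    simpa [real_inner_comm] using this
  obtain ⟨d, hd⟩ := banach_steinhaus hb
  exact ⟨d, fun x hx => by simpa using hd ⟨x, hx⟩⟩

lemma IsGammaZero.mem_edom_of_subdiff_nonempty {f : H → EReal} (hf : IsGammaZero f) {x : H}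
    (h : (subdiff f x).Nonempty) : x ∈ edom f := by
  obtain ⟨u, hu⟩ := h
  obtain ⟨w, hw⟩ := hf.proper
  refine (lt_top_iff_ne_top (α := EReal)).mpr fun hx => ?_
  have := hu w
  rw [hx, EReal.top_add_coe] at this
  exact (lt_of_le_of_lt this hw).ne rfl

lemma IsGammaZero.mem_subdiff_iff {f : H → EReal} (hf : IsGammaZero f) {x u : H}
    (hx : x ∈ edom f) :
    u ∈ subdiff f x ↔ ∀ y ∈ edom f, realVal f x + inner ℝ u (y - x) ≤ realVal f y := by
  have key : ∀ y ∈ edom f, (f x + ((inner ℝ u (y - x) : ℝ) : EReal) ≤ f y ↔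
      realVal f x + inner ℝ u (y - x) ≤ realVal f y) := by
    intro y hy
    rw [← hf.coe_realVal hx, ← hf.coe_realVal hy, ← EReal.coe_add, EReal.coe_le_coe_iff]
  refine ⟨fun h y hy => (key y hy).mp (h y), fun h y => ?_⟩
  by_cases hy : y ∈ edom f
  · exact (key y hy).mpr (h y hy)
  · exact le_top.trans_eq ((not_lt_top_iff (α := EReal)).mp hy).symm

/-- The subdifferential is closed and convex, so 0 has a projection onto it. Existence matters
because (A.4) bounds only minimal-norm elements. -/
lemma IsGammaZero.exists_isMinNormSubgrad [CompleteSpace H] {f : H → EReal} (hf : IsGammaZero f)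
    {x : H} (hne : (subdiff f x).Nonempty) : ∃ u, IsMinNormSubgrad f x u := by
  have hx := hf.mem_edom_of_subdiff_nonempty hne
  have heq : subdiff f x =
      ⋂ y ∈ edom f, {u | realVal f x + inner ℝ u (y - x) ≤ realVal f y} := by
    ext u
    simp [hf.mem_subdiff_iff hx]
  have hclosed : IsClosed (subdiff f x) := by
    rw [heq]
    refine isClosed_biInter fun y _ => isClosed_le ?_ continuous_const
    exact continuous_const.add (continuous_id.inner continuous_const)
  have hconv : Convex ℝ (subdiff f x) := by
    intro u hu v hv s t hs ht hst
    rw [hf.mem_subdiff_iff hx] at hu hv ⊢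
    intro y hy
    rw [inner_add_left, real_inner_smul_left, real_inner_smul_left]
    have h1 := mul_le_mul_of_nonneg_left (hu y hy) hs
    have h2 := mul_le_mul_of_nonneg_left (hv y hy) ht
    have h3 : t = 1 - s := by linarith
    subst h3
    linarith
  obtain ⟨u, hu, hmin⟩ := exists_norm_eq_iInf_of_complete_convex hne hclosed.isComplete hconv 0
  refine ⟨u, hu, fun v hv => ?_⟩
  simp only [zero_sub, norm_neg] at hmin
  rw [hmin]
  exact ciInf_le (f := fun w : subdiff f x => ‖(w : H)‖)
    ⟨0, Set.forall_mem_range.mpr fun _ => norm_nonneg _⟩ ⟨v, hv⟩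

lemma IsProx.mem_edom {f : H → EReal} (hf : IsGammaZero f) {β : ℝ} {x y : H}
    (h : IsProx β f x y) : y ∈ edom f := by
  obtain ⟨w, hw⟩ := hf.proper
  refine (lt_top_iff_ne_top (α := EReal)).mpr fun hy => ?_
  have := h w
  rw [hy, EReal.top_add_coe, ← hf.coe_realVal hw, ← EReal.coe_add, top_le_iff] at this
  exact EReal.coe_ne_top _ this

/-- The optimality condition of the proximal point: `(x - y) / β` is a subgradient at `y`. -/
lemma IsProx.subgradient {f : H → EReal} (hf : IsGammaZero f) {β : ℝ} {x y : H}
    (h : IsProx β f x y) {w : H} (hw : w ∈ edom f) :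
    realVal f y + inner ℝ (β⁻¹ • (x - y)) (w - y) ≤ realVal f w := by
  have hy := h.mem_edom hf
  suffices 0 ≤ realVal f w - realVal f y - inner ℝ (β⁻¹ • (x - y)) (w - y) by linarith
  -- Comparing y with (1 - t)y + tw and dividing by t leaves an error t ‖w - y‖²/(2β), which
  -- vanishes as t → 0.
  refine nonneg_of_forall_nonneg_add_mul (c := 1 / (2 * β) * ‖w - y‖ ^ 2) fun t ht => ?_
  have h1 := h ((1 - t) • y + t • w)
  have h2 := h1.trans (add_le_add (hf.convex_combo hy hw (sub_nonneg.mpr ht.2) ht.1.le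
    (sub_add_cancel 1 t)) le_rfl)
  rw [← hf.coe_realVal hy, ← EReal.coe_add, ← EReal.coe_add, EReal.coe_le_coe_iff] at h2
  have h3 : x - ((1 - t) • y + t • w) = (x - y) - t • (w - y) := by module
  rw [h3, norm_sub_sq_real (x - y), real_inner_smul_right, norm_smul, Real.norm_of_nonneg ht.1.le]
    at h2
  rw [real_inner_smul_left]
  refine nonneg_of_mul_nonneg_right ?_ ht.1
  have h4 : 1 / (2 * β) * (2 * (t * inner ℝ (x - y) (w - y))) =
      t * (β⁻¹ * inner ℝ (x - y) (w - y)) := by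
    rw [one_div, mul_inv]; ring
  linarith

/-- With p = (x - y)/β, adding the subgradient inequalities of u at x and of p at y gives β‖p‖² ≤
β⟪u, p⟫. The bound is uniform in β. -/
lemma IsProx.norm_le_of_mem_subdiff {f : H → EReal} (hf : IsGammaZero f) {β : ℝ} (hβ : 0 < β)
    {x y u : H} (h : IsProx β f x y) (hu : u ∈ subdiff f x) : ‖β⁻¹ • (x - y)‖ ≤ ‖u‖ := by
  have hy := h.mem_edom hf
  have hx := hf.mem_edom_of_subdiff_nonempty ⟨u, hu⟩
  have h1 := (hf.mem_subdiff_iff hx).mp hu y hy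
  have h2 := h.subgradient hf hx
  set p := β⁻¹ • (x - y) with hp
  have hxy : x - y = β • p := by rw [hp, smul_smul, mul_inv_cancel₀ hβ.ne', one_smul]
  rw [← neg_sub x y, hxy, inner_neg_right, real_inner_smul_right] at h1
  rw [hxy, real_inner_smul_right, real_inner_self_eq_norm_sq] at h2
  have h3 : β * ‖p‖ ^ 2 ≤ β * (‖u‖ * ‖p‖) :=
    le_trans (by linarith) (mul_le_mul_of_nonneg_left (real_inner_le_norm u p) hβ.le)
  have h4 := le_of_mul_le_mul_left h3 hβ
  by_contra! hlt
  nlinarith [norm_nonneg u]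

/-- The quadratic penalization of `f` is bounded below by the value of the dual quadratic at a
subgradient. -/
lemma le_add_of_subgradient {c q β : ℝ} (hβ : 0 < β) {p v w y : H}
    (h : c + inner ℝ p (w - y) ≤ q) :
    c + inner ℝ p (v - y) - β / 2 * ‖p‖ ^ 2 ≤ q + 1 / (2 * β) * ‖v - w‖ ^ 2 := by
  have h1 : (0 : ℝ) ≤ 1 / (2 * β) * ‖(v - w) - β • p‖ ^ 2 := by positivity
  rw [norm_sub_sq_real, real_inner_smul_right, norm_smul, Real.norm_of_nonneg hβ.le] at h1
  have h2 : inner ℝ p (v - y) = inner ℝ p (v - w) + inner ℝ p (w - y) := by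
    rw [← inner_add_right, sub_add_sub_cancel]
  have h3 : 1 / (2 * β) * (‖v - w‖ ^ 2 - 2 * (β * inner ℝ (v - w) p) + (β * ‖p‖) ^ 2) =
      1 / (2 * β) * ‖v - w‖ ^ 2 - inner ℝ p (v - w) + β / 2 * ‖p‖ ^ 2 := by
    rw [real_inner_comm]; field_simp
  linarith

/-- The first-order inequality for the convex function F - f bounds the Bregman remainder of f by
that of F. -/
lemma IsFZetaSmooth.descent [CompleteSpace H] {F f : H → EReal} {ζ : ℝ → ℝ} {C : Set H}
    (h : IsFZetaSmooth F ζ f C) (hC : Convex ℝ C) :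
    ∃ κ : ℝ, ∀ x ∈ C, ∀ s ∈ C, ∀ t ∈ Set.Ioc (0 : ℝ) 1,
      realVal f (x + t • (s - x)) ≤
        realVal f x + t * inner ℝ (gradient (realVal f) x) (s - x) + κ * ζ t := by
  obtain ⟨-, -, -, C₀, hopen, hCC₀, -, -, hF, hf, hconv, κ, hκ⟩ := h
  refine ⟨κ, fun x hx s hs t ht => ?_⟩
  have hz : x + t • (s - x) ∈ C := hC.add_smul_sub_mem hx hs ⟨ht.1.le, ht.2⟩
  have hFx := hF.differentiableAt (hopen.mem_nhds (hCC₀ hx))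
  have hfx := hf.differentiableAt (hopen.mem_nhds (hCC₀ hx))
  have h1 := inner_gradient_le_sub (hconv C hCC₀ hC) hx hz (hFx.sub hfx)
  have h2 := hκ x hx s hs t ht
  have h3 : gradient (fun x => realVal F x - realVal f x) x =
      gradient (realVal F) x - gradient (realVal f) x := by
    rw [gradient, fderiv_fun_sub hFx hfx, map_sub, gradient, gradient]
  rw [bregman] at h2
  rw [h3, inner_sub_left, add_sub_cancel_left] at h1
  rw [add_sub_cancel_left] at h2
  rw [real_inner_smul_right _ _ t, real_inner_smul_right _ _ t] at h1
  rw [real_inner_smul_right] at h2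
  linarith

end ConvexFunctions

/-! ### The augmented Lagrangian and its one-step estimates -/

section Energy

variable {Hp Hd Hv : Type*}
  [NormedAddCommGroup Hp] [InnerProductSpace ℝ Hp] [CompleteSpace Hp]
  [NormedAddCommGroup Hd] [InnerProductSpace ℝ Hd]
  [NormedAddCommGroup Hv] [InnerProductSpace ℝ Hv]
  {f : Hp → EReal} {g : Hv → EReal} {h : Hp → EReal}
  {T : Hp →L[ℝ] Hv} {A : Hp →L[ℝ] Hd} {b : Hd} {F : Hp → EReal} {ζ : ℝ → ℝ}

lemma ProblemAssumptions.mem_edom_f (hprob : ProblemAssumptions f g h T A b F ζ) {x : Hp}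
    (hx : x ∈ edom h) : x ∈ edom f :=
  hprob.smooth.2.2.1 hx

lemma ProblemAssumptions.differentiableAt (hprob : ProblemAssumptions f g h T A b F ζ) {x : Hp}
    (hx : x ∈ edom h) : DifferentiableAt ℝ (realVal f) x := by
  obtain ⟨-, -, -, C₀, hopen, hCC₀, -, -, -, hf, -⟩ := hprob.smooth
  exact hf.differentiableAt (hopen.mem_nhds (hCC₀ hx))

/-- Moving the multiplier from μ' to μ' + (A x' - b) adds ‖A x' - b‖² to a finite Lagrangian value
that is already maximal in μ. -/
lemma ProblemAssumptions.exists_feasible (hprob : ProblemAssumptions f g h T A b F ζ) {x₀ : Hp}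
    (hx₀ : x₀ ∈ edom h) : ∃ x ∈ edom h, A x = b := by
  obtain ⟨x', μ', hsad⟩ := hprob.saddle
  have hTx₀ : T x₀ ∈ edom g := hprob.g_mem.mem_edom_of_subdiff_nonempty
    (hprob.subdiff_nonempty x₀ hx₀)
  have hfin : lagrangian f g h T A b x' μ' < ⊤ := by
    refine lt_of_le_of_lt (hsad x₀ μ').2 ?_
    rw [lagrangian, ← hprob.f_mem.coe_realVal (hprob.mem_edom_f hx₀),
      ← hprob.g_mem.coe_realVal hTx₀, ← hprob.h_mem.coe_realVal hx₀]
    exact_mod_cast EReal.coe_lt_top _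
  have hf0 := hprob.f_mem.ne_bot x'
  have hg0 := hprob.g_mem.ne_bot (T x')
  have hh0 := hprob.h_mem.ne_bot x'
  have hfg0 : f x' + g (T x') ≠ ⊥ := by simp [EReal.add_eq_bot_iff, hf0, hg0]
  have hfgh0 : f x' + g (T x') + h x' ≠ ⊥ := by simp [EReal.add_eq_bot_iff, hf0, hg0, hh0]
  have htop : f x' + g (T x') + h x' ≠ ⊤ := by
    intro htop
    rw [lagrangian, htop, EReal.top_add_coe] at hfin
    exact lt_irrefl _ hfin
  have hx' : x' ∈ edom h := by
    refine (lt_top_iff_ne_top (α := EReal)).mpr fun hh => htop ?_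
    rw [hh, EReal.add_top_of_ne_bot hfg0]
  refine ⟨x', hx', ?_⟩
  obtain ⟨c, hc⟩ : ∃ c : ℝ, f x' + g (T x') + h x' = c :=
    ⟨_, (EReal.coe_toReal htop hfgh0).symm⟩
  have := (hsad x' (μ' + (A x' - b))).1
  rw [lagrangian, lagrangian, hc, ← EReal.coe_add, ← EReal.coe_add, EReal.coe_le_coe_iff,
    inner_add_left, real_inner_self_eq_norm_sq] at this
  have h0 : ‖A x' - b‖ = 0 := by nlinarith [norm_nonneg (A x' - b)]
  exact sub_eq_zero.mp (norm_eq_zero.mp h0)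

variable [CompleteSpace Hd] [CompleteSpace Hv]

/-- The augmented Lagrangian in which the smoothing of `g ∘ T` is split off: minimizing over `v`
replaces the smoothed term by the Moreau envelope of `g` at `T x`. -/
noncomputable def augLag (f : Hp → EReal) (g : Hv → EReal) (h : Hp → EReal)
    (T : Hp →L[ℝ] Hv) (A : Hp →L[ℝ] Hd) (b : Hd) (β ρ : ℝ) (μ : Hd) (x : Hp) (v : Hv) : ℝ :=
  realVal f x + realVal h x + (realVal g v + 1 / (2 * β) * ‖T x - v‖ ^ 2) +
    inner ℝ μ (A x - b) + ρ / 2 * ‖A x - b‖ ^ 2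

/-- The gradient at `x` of the smooth part of the augmented Lagrangian. -/
noncomputable def smoothGrad (f : Hp → EReal) (T : Hp →L[ℝ] Hv) (A : Hp →L[ℝ] Hd) (b : Hd)
    (β ρ : ℝ) (μ : Hd) (x : Hp) (y : Hv) : Hp :=
  gradient (realVal f) x + β⁻¹ • ContinuousLinearMap.adjoint T (T x - y)
    + ContinuousLinearMap.adjoint A μ + ρ • ContinuousLinearMap.adjoint A (A x - b)

lemma inner_smoothGrad (β ρ : ℝ) (μ : Hd) (x : Hp) (y : Hv) (w : Hp) :
    inner ℝ (smoothGrad f T A b β ρ μ x y) w =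
      inner ℝ (gradient (realVal f) x) w + β⁻¹ * inner ℝ (T x - y) (T w) + inner ℝ μ (A w) +
        ρ * inner ℝ (A x - b) (A w) := by
  simp only [smoothGrad, inner_add_left, real_inner_smul_left,
    ContinuousLinearMap.adjoint_inner_left]

/-- Linearizing f and the Moreau term at x only loses by convexity, while the quadratic penalty
expands exactly; its remainder is the extra ρ/2 ‖A x - A w‖². -/
lemma augLag_sub_le_gap (hprob : ProblemAssumptions f g h T A b F ζ) {β ρ : ℝ} (hβ : 0 < β)
    (μ : Hd) {x w : Hp} (hx : x ∈ edom h) (hw : w ∈ edom h) {y v : Hv} (hy : IsProx β g (T x) y)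
    (hv : v ∈ edom g) :
    augLag f g h T A b β ρ μ x y - augLag f g h T A b β ρ μ w v + ρ / 2 * ‖A x - A w‖ ^ 2 ≤
      realVal h x - realVal h w + inner ℝ (smoothGrad f T A b β ρ μ x y) (x - w) := by
  have hfconv : ConvexOn ℝ (edom h) (realVal f) :=
    hprob.f_mem.convexOn_realVal.subset hprob.smooth.2.2.1 hprob.h_mem.convex_edom
  have h1 := inner_gradient_le_sub hfconv hx hw (hprob.differentiableAt hx)
  have h2 := le_add_of_subgradient (v := T w) hβ (hy.subgradient hprob.g_mem hv)
  have h3 : T w - y = (T x - y) - (T x - T w) := by abel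
  have h4 : A w - b = (A x - b) - (A x - A w) := by abel
  rw [h3, norm_smul, inner_sub_right, real_inner_smul_left, real_inner_smul_left,
    real_inner_self_eq_norm_sq, Real.norm_of_nonneg (inv_nonneg.mpr hβ.le)] at h2
  have h5 : β / 2 * (β⁻¹ * ‖T x - y‖) ^ 2 = 1 / (2 * β) * ‖T x - y‖ ^ 2 := by
    field_simp
  have h6 : β⁻¹ * ‖T x - y‖ ^ 2 = 2 * (1 / (2 * β) * ‖T x - y‖ ^ 2) := by
    field_simp
  rw [← neg_sub x w, inner_neg_right] at h1
  simp only [augLag, inner_smoothGrad, map_sub]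
  rw [h4, norm_sub_sq_real (A x - b), inner_sub_right μ (A x - b)]
  rw [h5, h6] at h2
  linarith

/-- With v = y frozen, both quadratics expand exactly in t; their curvatures produce the t²/β and ρ
t² terms. -/
lemma augLag_descent (hprob : ProblemAssumptions f g h T A b F ζ) {κ : ℝ}
    (hκ : ∀ x ∈ edom h, ∀ s ∈ edom h, ∀ t ∈ Set.Ioc (0 : ℝ) 1,
      realVal f (x + t • (s - x)) ≤
        realVal f x + t * inner ℝ (gradient (realVal f) x) (s - x) + κ * ζ t)
    {β ρ : ℝ} (hβ : 0 < β) (hρ : 0 ≤ ρ) (μ : Hd) {x s : Hp} (hx : x ∈ edom h) (hs : s ∈ edom h)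
    (y : Hv) {t : ℝ} (ht : t ∈ Set.Ioc (0 : ℝ) 1) :
    augLag f g h T A b β ρ μ (x + t • (s - x)) y ≤ augLag f g h T A b β ρ μ x y +
      t * (realVal h s - realVal h x + inner ℝ (smoothGrad f T A b β ρ μ x y) (s - x)) +
      κ * ζ t + (‖T‖ ^ 2 * ‖s - x‖ ^ 2 / 2) * (t ^ 2 / β) +
      (‖A‖ ^ 2 * ‖s - x‖ ^ 2 / 2) * ρ * t ^ 2 := by
  have h1 := hκ x hx s hs t ht
  have h2 : realVal h (x + t • (s - x)) ≤ realVal h x + t * (realVal h s - realVal h x) := by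
    have := hprob.h_mem.convexOn_realVal.2 hx hs (sub_nonneg.mpr ht.2) ht.1.le
      (sub_add_cancel 1 t)
    rw [show (1 - t) • x + t • s = x + t • (s - x) by module, smul_eq_mul, smul_eq_mul] at this
    linarith
  have hT : ‖T (s - x)‖ ^ 2 ≤ ‖T‖ ^ 2 * ‖s - x‖ ^ 2 := by
    rw [← mul_pow]; exact pow_le_pow_left₀ (norm_nonneg _) (T.le_opNorm _) 2
  have hA : ‖A (s - x)‖ ^ 2 ≤ ‖A‖ ^ 2 * ‖s - x‖ ^ 2 := by
    rw [← mul_pow]; exact pow_le_pow_left₀ (norm_nonneg _) (A.le_opNorm _) 2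
  have h3 : 1 / (2 * β) * ‖T (x + t • (s - x)) - y‖ ^ 2 ≤ 1 / (2 * β) * ‖T x - y‖ ^ 2 +
      t * (β⁻¹ * inner ℝ (T x - y) (T (s - x))) +
      (‖T‖ ^ 2 * ‖s - x‖ ^ 2 / 2) * (t ^ 2 / β) := by
    rw [map_add, map_smul, add_sub_right_comm, norm_add_sq_real, real_inner_smul_right, norm_smul,
      Real.norm_of_nonneg ht.1.le]
    have : 1 / (2 * β) * (t * ‖T (s - x)‖) ^ 2 ≤ (‖T‖ ^ 2 * ‖s - x‖ ^ 2 / 2) * (t ^ 2 / β) := by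
      calc _ = ‖T (s - x)‖ ^ 2 / 2 * (t ^ 2 / β) := by field_simp
        _ ≤ _ := by gcongr
    have h' : 1 / (2 * β) * (2 * (t * inner ℝ (T x - y) (T (s - x)))) =
        t * (β⁻¹ * inner ℝ (T x - y) (T (s - x))) := by field_simp
    linarith
  have h4 : ρ / 2 * ‖A (x + t • (s - x)) - b‖ ^ 2 ≤ ρ / 2 * ‖A x - b‖ ^ 2 +
      t * (ρ * inner ℝ (A x - b) (A (s - x))) + (‖A‖ ^ 2 * ‖s - x‖ ^ 2 / 2) * ρ * t ^ 2 := by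
    rw [map_add, map_smul, add_sub_right_comm, norm_add_sq_real, real_inner_smul_right, norm_smul,
      Real.norm_of_nonneg ht.1.le]
    have : ρ / 2 * (t * ‖A (s - x)‖) ^ 2 ≤ (‖A‖ ^ 2 * ‖s - x‖ ^ 2 / 2) * ρ * t ^ 2 := by
      calc _ = ‖A (s - x)‖ ^ 2 / 2 * ρ * t ^ 2 := by ring
        _ ≤ _ := by gcongr
    linarith
  have h5 : inner ℝ μ (A (x + t • (s - x)) - b) =
      inner ℝ μ (A x - b) + t * inner ℝ μ (A (s - x)) := by
    rw [map_add, map_smul, add_sub_right_comm, inner_add_right, real_inner_smul_right]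
  simp only [augLag, inner_smoothGrad]
  rw [h5]
  linarith

/-- Decreasing the smoothing parameter from `β` to `β'` increases the Moreau envelope of `g` by at
most `(β - β') M² / 2`, if `g` has a subgradient of norm at most `M`. -/
lemma moreau_le_of_isProx {H : Type*} [NormedAddCommGroup H] [InnerProductSpace ℝ H]
    {g : H → EReal} (hg : IsGammaZero g) {β β' M : ℝ} (hβ' : 0 < β') (hββ' : β' ≤ β)
    {a y u v : H} (hy : IsProx β' g a y) (hu : u ∈ subdiff g a) (hM : ‖u‖ ≤ M)
    (hv : v ∈ edom g) :
    realVal g y + 1 / (2 * β') * ‖a - y‖ ^ 2 ≤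
      realVal g v + 1 / (2 * β) * ‖a - v‖ ^ 2 + (β - β') / 2 * M ^ 2 := by
  -- The affine minorant of slope q = (a - y)/β' at y is tested with the larger parameter β; the two
  -- sides differ by (β - β')/2 ‖q‖².
  have h1 := le_add_of_subgradient (v := a) (hβ'.trans_le hββ') (hy.subgradient hg hv)
  have hp := (hy.norm_le_of_mem_subdiff hg hβ' hu).trans hM
  rw [real_inner_smul_left, real_inner_self_eq_norm_sq] at h1
  have hn : ‖a - y‖ = β' * ‖β'⁻¹ • (a - y)‖ := by
    rw [norm_smul, Real.norm_of_nonneg (inv_nonneg.mpr hβ'.le), mul_inv_cancel_left₀ hβ'.ne']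
  set q := ‖β'⁻¹ • (a - y)‖ with hq
  rw [hn] at h1 ⊢
  have h2 : (β - β') / 2 * q ^ 2 ≤ (β - β') / 2 * M ^ 2 := by
    have : 0 ≤ β - β' := sub_nonneg.mpr hββ'
    have : 0 ≤ q := norm_nonneg _
    gcongr
  have h3 : β'⁻¹ * (β' * q) ^ 2 = β' * q ^ 2 := by field_simp
  have h4 : 1 / (2 * β') * (β' * q) ^ 2 = β' / 2 * q ^ 2 := by field_simp
  linarith

end Energy

lemma summable_of_le_sub_add {V r q : ℕ → ℝ} {B : ℝ} (hV : ∀ k, -B ≤ V k) (hq : ∀ k, 0 ≤ q k)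
    (hr : Summable r) (h : ∀ k, V (k + 1) ≤ V k + r k - q k) : Summable q := by
  obtain ⟨R, hR⟩ := hr.hasSum.tendsto_sum_nat.bddAbove_range
  refine summable_of_sum_range_le (c := V 0 + R + B) hq fun n => ?_
  have : V n ≤ V 0 + ∑ k ∈ Finset.range n, r k - ∑ k ∈ Finset.range n, q k := by
    induction n with
    | zero => simp
    | succ n ih =>
      rw [Finset.sum_range_succ, Finset.sum_range_succ]
      linarith [h n]
  linarith [hV n, hR ⟨n, rfl⟩]

/-! ### The potential along one trajectory -/

section Trajectory

lemma summable_sub_of_antitone {β : ℕ → ℝ} (hβ : Antitone β) {c : ℝ} (hc : ∀ k, c ≤ β k) :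
    Summable fun k => β k - β (k + 1) := by
  refine summable_of_sum_range_le (c := β 0 - c) (fun k => sub_nonneg.mpr (hβ k.le_succ))
    fun n => ?_
  rw [Finset.sum_range_sub']
  linarith [hc n]

lemma norm_sub_le_two_mul {E : Type*} [SeminormedAddCommGroup E] {D : ℝ} {C : Set E}
    (hD : ∀ w ∈ C, ‖w‖ ≤ D) {v w : E} (hv : v ∈ C) (hw : w ∈ C) : ‖v - w‖ ≤ 2 * D := by
  linarith [norm_sub_le v w, hD v hv, hD w hw]

variable {Hp Hd Hv : Type*}
  [NormedAddCommGroup Hp] [InnerProductSpace ℝ Hp]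
  [NormedAddCommGroup Hd] [InnerProductSpace ℝ Hd]
  [NormedAddCommGroup Hv] [InnerProductSpace ℝ Hv]
  {f : Hp → EReal} {g : Hv → EReal} {h : Hp → EReal}
  {T : Hp →L[ℝ] Hv} {A : Hp →L[ℝ] Hd} {b : Hd} {F : Hp → EReal} {ζ : ℝ → ℝ} {p : Params}
  {x : ℕ → Hp} {μ : ℕ → Hd} {y : ℕ → Hv} {z s s' : ℕ → Hp} {e : ℕ → Hp} {ε : ℕ → ℝ≥0}

lemma lmo_lt_top {z w : Hp} (hw : w ∈ edom h) : lmo h z w < ⊤ :=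
  EReal.add_lt_top (ne_of_lt hw) (EReal.coe_ne_top _)

/-- Dual side of a parameter update: holding at every (w, v), it bounds from below the growth of the
dual values. -/
lemma augLag_add_le {β β' ρ ρ' : ℝ} (hβ' : 0 < β') (hββ' : β' ≤ β) (hρ : ρ ≤ ρ') (μ a : Hd)
    (θ : ℝ) (w : Hp) (v : Hv) :
    augLag f g h T A b β ρ μ w v + θ * inner ℝ a (A w - b) ≤
      augLag f g h T A b β' ρ' (μ + θ • a) w v := by
  have h1 : 1 / (2 * β) * ‖T w - v‖ ^ 2 ≤ 1 / (2 * β') * ‖T w - v‖ ^ 2 := by gcongr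
  have h2 : ρ / 2 * ‖A w - b‖ ^ 2 ≤ ρ' / 2 * ‖A w - b‖ ^ 2 := by gcongr
  simp only [augLag, inner_add_left, real_inner_smul_left]
  linarith

/-- Primal side of a parameter update: the multiplier moves along A x - b itself, so its
contribution is a full square. -/
lemma augLag_le_of_isProx (hg : IsGammaZero g) {β β' ρ ρ' M : ℝ} (hβ' : 0 < β') (hββ' : β' ≤ β)
    (μ : Hd) (θ : ℝ) {x : Hp} {y u v : Hv} (hy : IsProx β' g (T x) y) (hu : u ∈ subdiff g (T x))
    (hM : ‖u‖ ≤ M) (hv : v ∈ edom g) :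
    augLag f g h T A b β' ρ' (μ + θ • (A x - b)) x y ≤ augLag f g h T A b β ρ μ x v +
      (β - β') / 2 * M ^ 2 + θ * ‖A x - b‖ ^ 2 + (ρ' - ρ) / 2 * ‖A x - b‖ ^ 2 := by
  have h1 := moreau_le_of_isProx hg hβ' hββ' hy hu hM hv
  simp only [augLag, inner_add_left, real_inner_smul_left, real_inner_self_eq_norm_sq]
  linarith

variable [CompleteSpace Hp] [CompleteSpace Hd] [CompleteSpace Hv]

lemma IsTrajectory.s'_mem (ht : IsTrajectory f g h T A b p x μ y z s s' e ε) (k : ℕ) :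
    s' k ∈ edom h := by
  have h1 : lmo h (z k) (s' k) < ⊤ := lt_of_le_of_lt (ht.s'_step k) (EReal.add_lt_top
    (ne_of_lt ((ht.s_step k (x 0)).trans_lt (lmo_lt_top ht.x_zero))) (EReal.coe_ne_top _))
  refine (lt_top_iff_ne_top (α := EReal)).mpr fun htop => ?_
  rw [lmo, htop, EReal.top_add_coe] at h1
  exact lt_irrefl _ h1

lemma IsTrajectory.x_succ (ht : IsTrajectory f g h T A b p x μ y z s s' e ε) (k : ℕ) :
    x (k + 1) = x k + p.γ k • (s' k - x k) := by
  rw [ht.x_step]; module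

lemma IsTrajectory.x_mem (ht : IsTrajectory f g h T A b p x μ y z s s' e ε)
    (hC : Convex ℝ (edom h)) (hγ : ∀ k, p.γ k ∈ Set.Ioc (0 : ℝ) 1) (k : ℕ) : x k ∈ edom h := by
  induction k with
  | zero => exact ht.x_zero
  | succ k ih =>
    rw [ht.x_succ]
    exact hC.add_smul_sub_mem ih (ht.s'_mem k) ⟨(hγ k).1.le, (hγ k).2⟩

lemma IsTrajectory.lmo_le (ht : IsTrajectory f g h T A b p x μ y z s s' e ε)
    (hh : IsGammaZero h) (k : ℕ) {w : Hp} (hw : w ∈ edom h) :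
    realVal h (s' k) + inner ℝ (z k) (s' k) ≤ realVal h w + inner ℝ (z k) w + ε k := by
  have h1 := (ht.s'_step k).trans (add_le_add (ht.s_step k w) le_rfl)
  rw [lmo, lmo, ← hh.coe_realVal (ht.s'_mem k), ← hh.coe_realVal hw] at h1
  exact_mod_cast h1

/-- The inexact linear minimization step controls the gap of the augmented Lagrangian. -/
lemma IsTrajectory.gap_le (ht : IsTrajectory f g h T A b p x μ y z s s' e ε)
    (hprob : ProblemAssumptions f g h T A b F ζ) (hparam : ParamAssumptions ζ p) {D : ℝ}
    (hD : ∀ w ∈ edom h, ‖w‖ ≤ D) (k : ℕ) {w : Hp} (hw : w ∈ edom h) {v : Hv} (hv : v ∈ edom g) :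
    realVal h (s' k) - realVal h (x k) +
        inner ℝ (smoothGrad f T A b (p.β k) (p.ρ k) (μ k) (x k) (y k)) (s' k - x k) ≤
      ε k + 2 * D * ‖e k‖ - (augLag f g h T A b (p.β k) (p.ρ k) (μ k) (x k) (y k) -
        augLag f g h T A b (p.β k) (p.ρ k) (μ k) w v + p.ρ k / 2 * ‖A (x k) - A w‖ ^ 2) := by
  have hx := ht.x_mem hprob.h_mem.convex_edom hparam.γ_mem k
  have h1 := augLag_sub_le_gap (ρ := p.ρ k) hprob (hparam.β_pos k) (μ k) hx hw (ht.y_step k) hv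
  have h2 := ht.lmo_le hprob.h_mem k hw
  have hz : z k = smoothGrad f T A b (p.β k) (p.ρ k) (μ k) (x k) (y k) + e k := ht.z_step k
  rw [hz, inner_add_left, inner_add_left] at h2
  have h3 : inner ℝ (e k) (w - s' k) ≤ 2 * D * ‖e k‖ := by
    refine (real_inner_le_norm _ _).trans ?_
    rw [mul_comm]
    gcongr
    exact norm_sub_le_two_mul hD hw (ht.s'_mem k)
  rw [inner_sub_right] at h1 h3 ⊢
  linarith

/-- The augmented Lagrangian is bounded below, and its infimum can be approached. -/
lemma IsTrajectory.exists_dual_value (ht : IsTrajectory f g h T A b p x μ y z s s' e ε)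
    (hprob : ProblemAssumptions f g h T A b F ζ) (hparam : ParamAssumptions ζ p) {η : ℝ}
    (hη : 0 < η) (k : ℕ) :
    ∃ φ : ℝ, (∀ w ∈ edom h, ∀ v ∈ edom g,
        φ ≤ augLag f g h T A b (p.β k) (p.ρ k) (μ k) w v) ∧
      ∃ w ∈ edom h, ∃ v ∈ edom g, augLag f g h T A b (p.β k) (p.ρ k) (μ k) w v ≤ φ + η := by
  obtain ⟨D, hD⟩ := hprob.weaklyCompact.exists_norm_le
  have hρ : 0 ≤ p.ρ k := by
    obtain ⟨ρ₁, _, _, _, _, hρ₁, hρ, -⟩ := hparam.bounds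
    exact hρ₁.le.trans (hρ k).1
  let V : Set ℝ := (fun q : Hp × Hv => augLag f g h T A b (p.β k) (p.ρ k) (μ k) q.1 q.2) ''
    (edom h ×ˢ edom g)
  -- The oracle inequality at the current iterate holds against every (w, v), which already bounds J
  -- from below.
  have hbdd : BddBelow V := by
    refine ⟨realVal h (s' k) - realVal h (x k) +
      inner ℝ (smoothGrad f T A b (p.β k) (p.ρ k) (μ k) (x k) (y k)) (s' k - x k) -
      (ε k + 2 * D * ‖e k‖) + augLag f g h T A b (p.β k) (p.ρ k) (μ k) (x k) (y k), ?_⟩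
    rintro _ ⟨⟨w, v⟩, ⟨hw, hv⟩, rfl⟩
    have h1 := ht.gap_le hprob hparam hD k hw hv
    have h2 : 0 ≤ p.ρ k / 2 * ‖A (x k) - A w‖ ^ 2 := by positivity
    dsimp only
    linarith
  have hne : V.Nonempty := (hprob.h_mem.proper.prod hprob.g_mem.proper).image _
  refine ⟨sInf V, fun w hw v hv => csInf_le hbdd ⟨(w, v), ⟨hw, hv⟩, rfl⟩, ?_⟩
  obtain ⟨_, ⟨⟨w, v⟩, ⟨hw, hv⟩, rfl⟩, hlt⟩ := exists_lt_of_csInf_lt hne (lt_add_of_pos_right _ hη)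
  exact ⟨w, hw, v, hv, hlt.le⟩

/-- The feasibility gap along a trajectory is square summable with weights `γ`. -/
theorem IsTrajectory.summable_mul_sq (ht : IsTrajectory f g h T A b p x μ y z s s' e ε)
    (hprob : ProblemAssumptions f g h T A b F ζ) (hparam : ParamAssumptions ζ p)
    (he : Summable fun k => p.γ k * ‖e k‖) (hε : Summable fun k => p.γ k * (ε k : ℝ)) :
    Summable fun k => p.γ k * ‖A (x k) - b‖ ^ 2 := by
  obtain ⟨ρ₁, ρ₂, γ₁, γ₂, c, hρ₁, hρ, hγ₁, hγ₂, hγγ, hc, hθ, hneg⟩ := hparam.bounds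
  obtain ⟨D, hD⟩ := hprob.weaklyCompact.exists_norm_le
  obtain ⟨κ, hκ⟩ := hprob.smooth.descent hprob.h_mem.convex_edom
  obtain ⟨M, hM⟩ := hprob.subdiff_bounded
  obtain ⟨xs, hxs, hAxs⟩ := hprob.exists_feasible ht.x_zero
  have hx := ht.x_mem hprob.h_mem.convex_edom hparam.γ_mem
  have hγ : ∀ k, 0 < p.γ k := fun k => (hparam.γ_mem k).1
  have hβ := hparam.β_pos
  have hγup : ∀ k, p.γ k ≤ γ₂ * p.γ (k + 1) := fun k => (div_le_iff₀ (hγ _)).mp (hγγ k).2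
  have hγlow : ∀ k, γ₁ * p.γ (k + 1) ≤ p.γ k := fun k => (le_div_iff₀ (hγ _)).mp (hγγ k).1
  have hη : ∀ k : ℕ, (0 : ℝ) < (1 / 2) ^ k := fun k => by positivity
  set J : ℕ → Hp → Hv → ℝ := fun k => augLag f g h T A b (p.β k) (p.ρ k) (μ k) with hJ
  choose φ hφ xt hxt yt hyt hmin using fun k => ht.exists_dual_value hprob hparam (hη k) k
  set u : ℕ → ℝ := fun k => ‖A (x k) - A (xt k)‖ ^ 2 with hu
  set w : ℕ → ℝ := fun k => ‖A (xt k) - b‖ ^ 2 with hw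
  have hu0 : ∀ k, 0 ≤ u k := fun k => sq_nonneg _
  have hw0 : ∀ k, 0 ≤ w k := fun k => sq_nonneg _
  have hyk : ∀ k, y k ∈ edom g := fun k => (ht.y_step k).mem_edom hprob.g_mem
  have huB : ∀ k, u k ≤ ‖A‖ ^ 2 * (2 * D) ^ 2 := by
    intro k
    rw [hu]
    dsimp only
    rw [← map_sub]
    calc _ ≤ (‖A‖ * ‖x k - xt k‖) ^ 2 := pow_le_pow_left₀ (norm_nonneg _) (A.le_opNorm _) 2
      _ = ‖A‖ ^ 2 * ‖x k - xt k‖ ^ 2 := mul_pow _ _ _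
      _ ≤ _ := by gcongr; exact norm_sub_le_two_mul hD (hx k) (hxt k)
  have hAB : ∀ k, ‖A (x k) - b‖ ^ 2 ≤ (‖A‖ * D + ‖b‖) ^ 2 := by
    intro k
    refine pow_le_pow_left₀ (norm_nonneg _) ((norm_sub_le _ _).trans ?_) 2
    gcongr
    exact (A.le_opNorm _).trans (by gcongr; exact hD _ (hx k))
  have hφle : ∀ k, φ k ≤ realVal f xs + realVal h xs + realVal g (T xs) := by
    intro k
    have := hφ k xs hxs (T xs)
      (hprob.g_mem.mem_edom_of_subdiff_nonempty (hprob.subdiff_nonempty xs hxs))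
    simpa [augLag, hAxs] using this
  set r : ℕ → ℝ := fun k => p.γ k * (ε k : ℝ) + 2 * D * (p.γ k * ‖e k‖) + (1 / 2) ^ k +
    2 * (1 / 2) ^ (k + 1) + κ * ζ (p.γ k) +
    (‖T‖ ^ 2 * (2 * D) ^ 2 / 2) * (p.γ k ^ 2 / p.β k) +
    (‖A‖ ^ 2 * (2 * D) ^ 2 / 2) * ρ₂ * p.γ k ^ 2 + M ^ 2 / 2 * (p.β k - p.β (k + 1)) +
    (‖A‖ * D + ‖b‖) ^ 2 / 2 * (-p.ρ k - -p.ρ (k + 1)) with hr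
  have hγsq : Summable fun k => p.γ k ^ 2 := by
    refine Summable.of_nonneg_of_le (fun k => sq_nonneg _) (fun k => ?_)
      (hparam.γsqβ_summable.mul_left (p.β 0))
    rw [mul_div_assoc', le_div_iff₀ (hβ k), mul_comm]
    exact mul_le_mul_of_nonneg_right (hparam.β_antitone (Nat.zero_le k)) (sq_nonneg _)
  have hgeo : Summable fun k : ℕ => (1 / 2 : ℝ) ^ k :=
    summable_geometric_of_lt_one (by norm_num) (by norm_num)
  have hrs : Summable r := by
    refine (((((((hε.add (he.mul_left _)).add hgeo).add
      (((summable_nat_add_iff 1).mpr hgeo).mul_left 2)).add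
      (hparam.ζγ_summable.mul_left κ)).add (hparam.γsqβ_summable.mul_left _)).add
      (hγsq.mul_left _)).add ((summable_sub_of_antitone hparam.β_antitone
        fun k => (hβ k).le).mul_left _)).add ((summable_sub_of_antitone (β := fun k => -p.ρ k)
        hparam.ρ_monotone.neg fun k => neg_le_neg (hρ k).2).mul_left _)
  -- `e1`–`e5` estimate the primal change and `e6`, `e7` the dual one, used twice; `e8` turns the
  -- resulting square minus twice the inner product into u - w.
  have hstep : ∀ k, J (k + 1) (x (k + 1)) (y (k + 1)) - 2 * φ (k + 1) ≤
      J k (x k) (y k) - 2 * φ k + r k - ρ₁ / 2 * (p.γ k * u k) + p.θ k * u (k + 1) -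
        p.θ k * w (k + 1) := by
    intro k
    obtain ⟨v, hv⟩ := hprob.g_mem.exists_isMinNormSubgrad (hprob.subdiff_nonempty _ (hx (k + 1)))
    have hββ := hparam.β_antitone k.le_succ
    have hρρ := hparam.ρ_monotone k.le_succ
    have hρ0 : 0 ≤ p.ρ k := hρ₁.le.trans (hρ k).1
    have e1 : J (k + 1) (x (k + 1)) (y (k + 1)) ≤ J k (x (k + 1)) (y k) +
        (p.β k - p.β (k + 1)) / 2 * M ^ 2 + p.θ k * ‖A (x (k + 1)) - b‖ ^ 2 +
        (p.ρ (k + 1) - p.ρ k) / 2 * ‖A (x (k + 1)) - b‖ ^ 2 := by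
      simp only [hJ]
      rw [ht.μ_step k]
      exact augLag_le_of_isProx hprob.g_mem (hβ _) hββ _ _ (ht.y_step (k + 1)) hv.1
        (hM _ (hx _) _ hv) (hyk k)
    have e2 := augLag_descent hprob hκ (hβ k) hρ0 (μ k) (hx k) (ht.s'_mem k) (y k)
      (hparam.γ_mem k)
    rw [← ht.x_succ k] at e2
    change J k (x (k + 1)) (y k) ≤ J k (x k) (y k) + _ + _ + _ + _ at e2
    have e3 := mul_le_mul_of_nonneg_left
      (ht.gap_le hprob hparam hD k (hxt k) (hyt k)) (hγ k).le
    change _ ≤ p.γ k * (_ - (J k (x k) (y k) - J k (xt k) (yt k) + p.ρ k / 2 * u k)) at e3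
    have e4 : p.γ k * (J k (xt k) (yt k) - J k (x k) (y k)) ≤ (1 / 2) ^ k := by
      have h1 : J k (xt k) (yt k) - J k (x k) (y k) ≤ (1 / 2) ^ k := by
        linarith [hmin k, hφ k (x k) (hx k) (y k) (hyk k)]
      calc _ ≤ p.γ k * (1 / 2) ^ k := mul_le_mul_of_nonneg_left h1 (hγ k).le
        _ ≤ 1 * (1 / 2) ^ k := mul_le_mul_of_nonneg_right (hparam.γ_mem k).2 (hη k).le
        _ = _ := one_mul _
    have e5 : ρ₁ / 2 * (p.γ k * u k) ≤ p.γ k * (p.ρ k / 2 * u k) := by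
      have := (hρ k).1
      have := (hγ k).le
      have := hu0 k
      calc _ = p.γ k * (ρ₁ / 2 * u k) := by ring
        _ ≤ _ := by gcongr
    have e6 : J k (xt (k + 1)) (yt (k + 1)) +
        p.θ k * inner ℝ (A (x (k + 1)) - b) (A (xt (k + 1)) - b) ≤
          φ (k + 1) + (1 / 2) ^ (k + 1) := by
      refine le_trans ?_ (hmin (k + 1))
      simp only [hJ]
      rw [ht.μ_step k]
      exact augLag_add_le (hβ _) hββ hρρ _ _ _ _ _
    have e7 := hφ k (xt (k + 1)) (hxt _) (yt (k + 1)) (hyt _)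
    have e8 : u (k + 1) = ‖A (x (k + 1)) - b‖ ^ 2 -
        2 * inner ℝ (A (x (k + 1)) - b) (A (xt (k + 1)) - b) + w (k + 1) := by
      simp only [hu, hw]
      rw [← norm_sub_sq_real, sub_sub_sub_cancel_right]
    have hsx := norm_sub_le_two_mul hD (ht.s'_mem k) (hx k)
    have e9 : (‖T‖ ^ 2 * ‖s' k - x k‖ ^ 2 / 2) * (p.γ k ^ 2 / p.β k) ≤
        (‖T‖ ^ 2 * (2 * D) ^ 2 / 2) * (p.γ k ^ 2 / p.β k) := by
      have := (hβ k).le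
      gcongr
    have e10 : (‖A‖ ^ 2 * ‖s' k - x k‖ ^ 2 / 2) * p.ρ k * p.γ k ^ 2 ≤
        (‖A‖ ^ 2 * (2 * D) ^ 2 / 2) * ρ₂ * p.γ k ^ 2 := by
      have := (hρ k).2
      gcongr
    have e11 : (p.ρ (k + 1) - p.ρ k) / 2 * ‖A (x (k + 1)) - b‖ ^ 2 ≤
        (p.ρ (k + 1) - p.ρ k) / 2 * (‖A‖ * D + ‖b‖) ^ 2 :=
      mul_le_mul_of_nonneg_left (hAB _) (by linarith)
    rw [e8]
    simp only [hr]
    change φ k ≤ J k (xt (k + 1)) (yt (k + 1)) at e7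
    linarith
  -- The subtracted term carries the positive θ_k u_{k+1} over to the next step, where ρ₁/2 · γ u
  -- outweighs it.
  set V : ℕ → ℝ := fun k => J k (x k) (y k) - 2 * φ k - γ₂ / c * (p.γ k * u k) with hV
  have hq : Summable fun k => (ρ₁ / 2 - γ₂ / c) * (p.γ k * u k) +
      γ₁ / c * (p.γ (k + 1) * w (k + 1)) := by
    refine summable_of_le_sub_add (V := V) (r := r)
      (B := (realVal f xs + realVal h xs + realVal g (T xs)) +
        γ₂ / c * (‖A‖ ^ 2 * (2 * D) ^ 2)) (fun k => ?_) (fun k => ?_) hrs fun k => ?_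
    · have h1 : γ₂ / c * (p.γ k * u k) ≤ γ₂ / c * (‖A‖ ^ 2 * (2 * D) ^ 2) := by
        refine mul_le_mul_of_nonneg_left ?_ (by positivity)
        exact (mul_le_of_le_one_left (hu0 k) (hparam.γ_mem k).2).trans (huB k)
      have h2 : φ k ≤ J k (x k) (y k) := hφ k (x k) (hx k) (y k) (hyk k)
      simp only [hV]
      linarith [hφle k]
    · have h1 : 0 ≤ ρ₁ / 2 - γ₂ / c := by linarith
      have h2 := (hγ k).le
      have h3 := (hγ (k + 1)).le
      have h4 := hu0 k
      have h5 := hw0 (k + 1)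
      positivity
    · have h1 : p.θ k * u (k + 1) ≤ γ₂ / c * (p.γ (k + 1) * u (k + 1)) := by
        calc _ = p.γ k * u (k + 1) / c := by rw [hθ]; ring
          _ ≤ γ₂ * p.γ (k + 1) * u (k + 1) / c := by
            have := hu0 (k + 1)
            gcongr
            exact hγup k
          _ = _ := by ring
      have h2 : γ₁ / c * (p.γ (k + 1) * w (k + 1)) ≤ p.θ k * w (k + 1) := by
        calc _ = γ₁ * p.γ (k + 1) * w (k + 1) / c := by ring
          _ ≤ p.γ k * w (k + 1) / c := by
            have := hw0 (k + 1)
            gcongr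
            exact hγlow k
          _ = _ := by rw [hθ]; ring
      simp only [hV]
      linarith [hstep k]
  have hδ : 0 < ρ₁ / 2 - γ₂ / c := by linarith
  have hγ₁c : 0 < γ₁ / c := by positivity
  have hsu : Summable fun k => p.γ k * u k := by
    refine (summable_mul_left_iff hδ.ne').mp
      (Summable.of_nonneg_of_le (fun k => ?_) (fun k => ?_) hq)
    · exact mul_nonneg hδ.le (mul_nonneg (hγ k).le (hu0 k))
    · exact le_add_of_nonneg_right (mul_nonneg hγ₁c.le (mul_nonneg (hγ _).le (hw0 _)))
  have hsw : Summable fun k => p.γ k * w k := by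
    rw [← summable_nat_add_iff 1]
    refine (summable_mul_left_iff hγ₁c.ne').mp
      (Summable.of_nonneg_of_le (fun k => ?_) (fun k => ?_) hq)
    · exact mul_nonneg hγ₁c.le (mul_nonneg (hγ _).le (hw0 _))
    · exact le_add_of_nonneg_left (mul_nonneg hδ.le (mul_nonneg (hγ k).le (hu0 k)))
  refine Summable.of_nonneg_of_le (fun k => mul_nonneg (hγ k).le (sq_nonneg _)) (fun k => ?_)
    ((hsu.add hsw).mul_left 2)
  have h1 : ‖A (x k) - b‖ ^ 2 ≤ 2 * (u k + w k) := by
    have h2 : ‖A (x k) - b‖ ≤ ‖A (x k) - A (xt k)‖ + ‖A (xt k) - b‖ :=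
      norm_sub_le_norm_sub_add_norm_sub _ _ _
    calc _ ≤ (‖A (x k) - A (xt k)‖ + ‖A (xt k) - b‖) ^ 2 := by gcongr
      _ ≤ _ := add_sq_le
  calc _ ≤ p.γ k * (2 * (u k + w k)) := mul_le_mul_of_nonneg_left h1 (hγ k).le
    _ = _ := by ring

end Trajectory

end ICGALP

/-! ### Almost sure conclusions -/

theorem mainTheorem1
    {Ω Hp Hd Hv : Type*}
    [NormedAddCommGroup Hp] [InnerProductSpace ℝ Hp] [CompleteSpace Hp]
    [MeasurableSpace Hp] [BorelSpace Hp]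
    [NormedAddCommGroup Hd] [InnerProductSpace ℝ Hd] [CompleteSpace Hd]
    [MeasurableSpace Hd] [BorelSpace Hd]
    [NormedAddCommGroup Hv] [InnerProductSpace ℝ Hv] [CompleteSpace Hv]
    [MeasurableSpace Ω] (P : Measure Ω) [IsProbabilityMeasure P]
    (f : Hp → EReal) (g : Hv → EReal) (h : Hp → EReal)
    (T : Hp →L[ℝ] Hv) (A : Hp →L[ℝ] Hd) (b : Hd)
    (F : Hp → EReal) (ζ : ℝ → ℝ) (p : ICGALP.Params)
    (hprob : ICGALP.ProblemAssumptions f g h T A b F ζ)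
    (hparam : ICGALP.ParamAssumptions ζ p)
    (x : ℕ → Ω → Hp) (μ : ℕ → Ω → Hd) (y : ℕ → Ω → Hv) (z s s' : ℕ → Ω → Hp)
    (e : ℕ → Ω → Hp) (ε : ℕ → Ω → ℝ≥0)
    (hx₀ : Measurable (x 0)) (hμ₀ : Measurable (μ 0)) (hs' : ∀ k, Measurable (s' k))
    (he : ∀ k, Measurable (e k)) (hε : ∀ k, Measurable (ε k))
    (htraj : ∀ᵐ ω ∂P, ICGALP.IsTrajectory f g h T A b p (fun k => x k ω) (fun k => μ k ω)
      (fun k => y k ω) (fun k => z k ω) (fun k => s k ω) (fun k => s' k ω)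
      (fun k => e k ω) (fun k => ε k ω))
    (herr_e : ICGALP.CondSummable P (ICGALP.sigmaAlg (x 0) (μ 0) s') p.γ
      (fun k ω => ‖e k ω‖ₑ))
    (herr_ε : ICGALP.CondSummable P (ICGALP.sigmaAlg (x 0) (μ 0) s') p.γ
      (fun k ω => (ε k ω : ℝ≥0∞))) :
    (∀ᵐ ω ∂P, Tendsto (fun k => ‖A (x k ω) - b‖) atTop (𝓝 0)) ∧
    (∀ᵐ ω ∂P, (fun k : ℕ => ⨅ i : Fin (k + 1), ‖A (x i ω) - b‖)
      =O[atTop] (fun k => 1 / √(ICGALP.cumStep p.γ k))) ∧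
    (∀ᵐ ω ∂P, ∃ φ : ℕ → ℕ, StrictMono φ ∧
      ∀ j, ‖A (x (φ j) ω) - b‖ ≤ 1 / √(ICGALP.cumStep p.γ (φ j))) ∧
    (∀ᵐ ω ∂P, (fun k => ‖A (ICGALP.ergodicAvg p.γ (fun i => x i ω) k) - b‖)
      =O[atTop] (fun k => 1 / √(ICGALP.cumStep p.γ k))) := by
  have hγ : ∀ k, 0 < p.γ k := fun k => (hparam.γ_mem k).1
  have hmono := ICGALP.monotone_sigmaAlg (x 0) (μ 0) s'
  have hle := ICGALP.sigmaAlg_le hx₀ hμ₀ hs'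
  have hsum_e : ∀ᵐ ω ∂P, Summable fun k => p.γ k * ‖e k ω‖ :=
    ICGALP.CondSummable.ae_summable (X := fun k ω => ‖e k ω‖₊) herr_e hmono hle
      (fun k => (he k).nnnorm) fun k => (hγ k).le
  have hsum_ε := herr_ε.ae_summable hmono hle hε fun k => (hγ k).le
  have hmain : ∀ᵐ ω ∂P, Summable fun k => p.γ k * ‖A (x k ω) - b‖ ^ 2 := by
    filter_upwards [htraj, hsum_e, hsum_ε] with ω ht h1 h2
    exact ht.summable_mul_sq hprob hparam h1 h2
  refine ⟨?_, ?_, ?_, ?_⟩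
  · filter_upwards [htraj, hmain] with ω ht hs
    obtain ⟨_, _, _, γ₂, _, _, _, _, _, hγγ, -⟩ := hparam.bounds
    obtain ⟨D, hD⟩ := hprob.weaklyCompact.exists_norm_le
    refine ICGALP.tendsto_zero_of_summable_mul_sq (L := ‖A‖ * (2 * D)) (M := γ₂) hγ
      (fun k => norm_nonneg _) hparam.γ_not_summable hs
      (fun k => (div_le_iff₀ (hγ _)).mp (hγγ k).2) fun k => ?_
    -- One step moves x by γ_k times a difference of two points of dom h, whose norm is at most 2D.
    refine (abs_norm_sub_norm_le _ _).trans ?_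
    rw [sub_sub_sub_cancel_right, ← map_sub, ht.x_succ k, add_sub_cancel_left, map_smul, norm_smul,
      Real.norm_of_nonneg (hγ k).le, mul_comm]
    refine mul_le_mul_of_nonneg_right ((A.le_opNorm _).trans ?_) (hγ k).le
    exact mul_le_mul_of_nonneg_left (ICGALP.norm_sub_le_two_mul hD (ht.s'_mem k)
      (ht.x_mem hprob.h_mem.convex_edom hparam.γ_mem k)) (norm_nonneg _)
  · filter_upwards [hmain] with ω hs
    exact ICGALP.iInf_isBigO_inv_sqrt_cumStep hγ (fun k => norm_nonneg _) hs
  · filter_upwards [hmain] with ω hs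
    exact ICGALP.exists_subseq_le_inv_sqrt_cumStep hγ hparam.γ_not_summable hs
  · filter_upwards [hmain] with ω hs
    refine IsBigO.of_bound (√(∑' k, p.γ k * ‖A (x k ω) - b‖ ^ 2)) (Eventually.of_forall fun k => ?_)
    have hpos := ICGALP.cumStep_pos hγ k
    rw [norm_norm, Real.norm_of_nonneg (by positivity)]
    refine le_trans ?_ (ICGALP.weighted_mean_le_inv_sqrt_cumStep hγ hs k)
    -- The weights γ_i/Γ_k sum to 1, so b can be moved inside the average.
    have hb : A (ICGALP.ergodicAvg p.γ (fun i => x i ω) k) - b =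
        (ICGALP.cumStep p.γ k)⁻¹ • ∑ i ∈ Finset.range (k + 1), p.γ i • (A (x i ω) - b) := by
      simp only [smul_sub, Finset.sum_sub_distrib, ICGALP.ergodicAvg, map_smul, map_sum]
      rw [← Finset.sum_smul, ← ICGALP.cumStep, smul_smul, inv_mul_cancel₀ hpos.ne', one_smul]
    rw [hb, norm_smul, Real.norm_of_nonneg (inv_nonneg.mpr hpos.le)]
    refine mul_le_mul_of_nonneg_left ((norm_sum_le _ _).trans_eq ?_) (inv_nonneg.mpr hpos.le)
    exact Finset.sum_congr rfl fun i _ => by rw [norm_smul, Real.norm_of_nonneg (hγ i).le]
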